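/- Let $0<\beta\le 1$ and let $G=(G(x))_{x\in\mathbb R}$ be a centered stationary Gaussian random field with almost surely continuous realizations and covariance function $\mathcal C$, i.e. $\mathbb E[G(x)G(y)]=\mathcal C(x-y)$, where $\mathcal C$ is Hölder continuous at $0$ and $|\mathcal C(x)|\le M(1+|x|)^{-\beta}$ for some $M$ and all $x\in\mathbb R$. Assume $G\not\equiv0$ and set $a(x)=e^{G(x)}$. Let $\gamma:[0,\infty)\to[0,\infty)$ be bounded with $\lim_{t\downarrow0}\gamma(t)=0$. Assume asymptotic homogeneity of $\mathcal C$: * if $\beta=1$, there is $\bar{\mathcal C}\in\mathbb R$ such that $\big|\frac1{\log L}\int_{-L}^L\mathcal C(x)\,dx-\bar{\mathcal C}\big|\le\gamma(\tfrac1L)$ for all sufficiently large $L$; * if $0<\beta<1$, $\gamma$ is nondecreasing on $(0,\infty)$ and there are $\bar{\mathcal C}^+,\bar{\mathcal C}^-\in\mathbb R$ such that $|x^\beta\mathcal C(\pm x)-\bar{\mathcal C}^{\pm}|\le\gamma(\tfrac1x)$ for all $x>0$. Let $f,g\in C^1([0,1])$. For $\varepsilon\in(0,1)$ let $u_\varepsilon\in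 C^1([0,1])$ be the (almost surely unique) solution of $$\big(a(\tfrac x\varepsilon)u_\varepsilon'(x)\big)'=f'(x)\ \text{ on }(0,1),\qquad u_\varepsilon(0)=u_\varepsilon(1)=0,$$ and let $v_\varepsilon$ be the solution of the same problem with $f$ replaced by $g$. Then almost surely $I_\varepsilon(f,g):=\int_0^1u_\varepsilon'g=\int_0^1v_\varepsilon'f$, and $I_\varepsilon(f,g)$ is square integrable. Set $\sigma_\varepsilon(f,g):=\pi_\beta(\varepsilon)^{-1}\sqrt{\operatorname{Var}[I_\varepsilon(f,g)]}$ with $\pi_\beta(\varepsilon)=\varepsilon^{\beta/2}$ if $\beta<1$ and $\pi_1(\varepsilon)=\sqrt\varepsilon\,|\log\varepsilon|^{1/2}$. Then there is a constant $K<\infty$, independent of $\varepsilon$, such that for all $\varepsilon\in(0,1)$ $$|\sigma_\varepsilon(f,g)^2-\sigma(f,g)^2|\le K\,\Pi_\beta(\varepsilon),$$ where $$\Pi_\beta(\varepsilon)=\begin{cases}\varepsilon^{\beta\wedge(1-\beta)}+\inf_{\delta\in(0,1]}\big(\delta^{1-\beta}+\gamma(\delta^{-1}\varepsilon)\big),&0<\beta<1,\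 \beta\ne\frac12,\\ \varepsilon^{1/2}|\log\varepsilon|+\inf_{\delta\in(0,1]}\big(\delta^{1-\beta}+\gamma(\delta^{-1}\varepsilon)\big),&\beta=\frac12,\\ |\log\varepsilon|^{-1}+\gamma(\varepsilon),&\beta=1,\end{cases}$$ and $\sigma(f,g)^2:=\mathcal Q_\beta\big((f-\bar f)(g-\bar g)\big)$ with $\bar f=\int_0^1f$, $\bar g=\int_0^1g$ and $$\mathcal Q_\beta(h)=e^{\mathcal C(0)}\begin{cases}\int_0^1\int_0^1h(x)\,\bar{\mathcal C}^{\operatorname{sign}(x-y)}|x-y|^{-\beta}\,h(y)\,dx\,dy,&0<\beta<1,\\ \bar{\mathcal C}\int_0^1h(x)^2\,dx,&\beta=1.\end{cases}$$ -/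

import Mathlib

open MeasureTheory ProbabilityTheory Filter Topology Set

namespace LogNormalHomog

noncomputable section

/-- `G` is a centered stationary Gaussian random field on `ℝ` with covariance function `C`
(so that `E[G(x) G(y)] = C (x - y)`) and almost surely continuous realizations. -/
structure IsStationaryGaussianField {Ω : Type*} [MeasurableSpace Ω] (P : Measure Ω)
    (G : ℝ → Ω → ℝ) (C : ℝ → ℝ) : Prop where
  gaussian : IsGaussianProcess G P
  mean_zero : ∀ x, ∫ ω, G x ω ∂P = 0
  covariance_eq : ∀ x y, cov[G x, G y; P] = C (x - y)
  continuous_paths : ∀ᵐ ω ∂P, Continuous fun x => G x ω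

/-- Hölder continuity of `C` at the origin. -/
def HolderAtZero (C : ℝ → ℝ) : Prop :=
  ∃ α M r : ℝ, 0 < α ∧ 0 < r ∧ ∀ x, |x| ≤ r → |C x - C 0| ≤ M * |x| ^ α

/-- The decay `|C(x)| ≲ (1 + |x|)^{-β}`. -/
def DecaysWithExponent (C : ℝ → ℝ) (β : ℝ) : Prop :=
  ∃ M : ℝ, ∀ x, |C x| ≤ M * (1 + |x|) ^ (-β)

/-- `γ : [0, ∞) → [0, ∞)` is bounded and tends to `0` at `0`. -/
structure IsRate (γ : ℝ → ℝ) : Prop where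
  nonneg : ∀ t, 0 ≤ t → 0 ≤ γ t
  bounded : ∃ M : ℝ, ∀ t, 0 ≤ t → γ t ≤ M
  tendsto_zero : Tendsto γ (𝓝[>] 0) (𝓝 0)

/-- Asymptotic homogeneity of `C` with rate `γ`. The constant `Cbar` is relevant for `β = 1` only,
the constants `Cplus`, `Cminus` for `β < 1` only. -/
structure AsymptoticallyHomogeneous (β : ℝ) (C γ : ℝ → ℝ) (Cbar Cplus Cminus : ℝ) : Prop where
  rate : IsRate γ
  eq_one : β = 1 → ∀ᶠ L : ℝ in atTop,
    |1 / Real.log L * (∫ x in (-L)..L, C x) - Cbar| ≤ γ (1 / L)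
  lt_one : β < 1 → ∀ x : ℝ, 0 < x →
    |x ^ β * C x - Cplus| ≤ γ (1 / x) ∧ |x ^ β * C (-x) - Cminus| ≤ γ (1 / x)
  mono : β < 1 → MonotoneOn γ (Ioi 0)

/-- `u ∈ C¹([0,1])` solves `(a(x/ε) u'(x))' = f'(x)` on `(0,1)` with `u(0) = u(1) = 0`. -/
structure IsSolution (a : ℝ → ℝ) (ε : ℝ) (f u : ℝ → ℝ) : Prop where
  contDiffOn : ContDiffOn ℝ 1 u (Icc 0 1)
  equation : ∀ x ∈ Ioo (0 : ℝ) 1, HasDerivAt (fun y => a (y / ε) * deriv u y) (deriv f x) x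
  left : u 0 = 0
  right : u 1 = 0

/-- `∫₀¹ u'(x) g(x) dx`. -/
def gradAverage (u g : ℝ → ℝ) : ℝ := ∫ x in (0 : ℝ)..1, deriv u x * g x

/-- The fluctuation scaling `π_β(ε)` for `0 < β ≤ 1`. -/
def piRate (β ε : ℝ) : ℝ :=
  if β < 1 then ε ^ (β / 2) else √ε * |Real.log ε| ^ (1 / 2 : ℝ)

/-- `σ_ε = π_β(ε)⁻¹ √Var[I]`. -/
def sigmaEps {Ω : Type*} [MeasurableSpace Ω] (P : Measure Ω) (β ε : ℝ) (I : Ω → ℝ) : ℝ :=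
  (piRate β ε)⁻¹ * √(Var[I; P])

/-- `inf_{δ ∈ (0,1]} (δ^{1-β} + γ(δ⁻¹ ε))`. -/
def infTerm (β : ℝ) (γ : ℝ → ℝ) (ε : ℝ) : ℝ :=
  sInf ((fun δ : ℝ => δ ^ (1 - β) + γ (δ⁻¹ * ε)) '' Ioc 0 1)

/-- The convergence rate `Π_β(ε)` for `0 < β ≤ 1`. -/
def PiRate (β : ℝ) (γ : ℝ → ℝ) (ε : ℝ) : ℝ :=
  if β = 1 then |Real.log ε|⁻¹ + γ ε
  else if β = 1 / 2 then ε ^ (1 / 2 : ℝ) * |Real.log ε| + infTerm β γ ε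
  else ε ^ (min β (1 - β)) + infTerm β γ ε

/-- The quadratic form `Q_β` for `0 < β ≤ 1`; the kernel for `β < 1` is
`C̄^{sign(x-y)} |x-y|^{-β}`, the diagonal being negligible. -/
def quadForm (β C₀ Cbar Cplus Cminus : ℝ) (h : ℝ → ℝ) : ℝ :=
  Real.exp C₀ *
    if β < 1 then
      ∫ x in (0 : ℝ)..1, ∫ y in (0 : ℝ)..1,
        h x * ((if y < x then Cplus else Cminus) * |x - y| ^ (-β)) * h y
    else Cbar * ∫ x in (0 : ℝ)..1, h x ^ 2

/-- `f - f̄` with `f̄ = ∫₀¹ f`. -/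
def centered (f : ℝ → ℝ) (x : ℝ) : ℝ := f x - ∫ y in (0 : ℝ)..1, f y

/-- The limiting variance `σ(f,g)² = Q_β((f - f̄)(g - ḡ))`. -/
def sigmaSq (β C₀ Cbar Cplus Cminus : ℝ) (f g : ℝ → ℝ) : ℝ :=
  quadForm β C₀ Cbar Cplus Cminus fun x => centered f x * centered g x

end

end LogNormalHomog

/-!
Integrating the equation once gives `u'(x) = exp (-G(x/ε)) (f(x) - c)` with a random constant `c`
fixed by the boundary values, so that `I_ε(f, g)` is `∫₀¹ w` times the covariance of `f` and `g`
under the probability density `w / ∫₀¹ w` on `[0, 1]`, where `w(x) = exp (-G(x/ε))`. This quantity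
is unchanged by adding constants to `f` and `g`. With `f` and `g` centered and
`m = E w = e^{C(0)/2}`, it equals a constant plus `∫₀¹ f g (w - m)` minus the product of the
fluctuation integrals `∫₀¹ f (w - m)` and `∫₀¹ g (w - m)` divided by `∫₀¹ w`.

The mixed moments of `w - m` expand over sets of directed edges meeting every vertex, with one
factor `exp (C / 2) - 1` per edge. At least half of the vertices can each be joined by such an edge
to the other vertices, and integrating them out gives one factor `∫₀¹ (1 + z/ε)^{-β} dz` each.
Hence third and fourth moments of fluctuation integrals are of the order of the square of that
factor, which is negligible compared with `π_β(ε)²`.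

What remains is `e^{C(0)} ∫∫ h(x) h(y) (exp C((x - y)/ε) - 1) dx dy` with `h = (f - f̄)(g - ḡ)`.
Replacing `exp C - 1` by `C` costs a term with the doubled decay exponent `2β`. For `β < 1` the
homogeneity of `C` is used where `|x - y| ≥ δ`, while `|x - y| < δ` contributes `O(δ^{1-β})`; for
`β = 1` the double integral is that of `C` against the Lipschitz autocorrelation of `h` and
concentrates on the diagonal.
-/

namespace LogNormalHomog

section EdgeSets

variable {ι : Type*} [Fintype ι] [DecidableEq ι]

/-- The vertices that no edge of the set `E` of directed edges meets. -/
def isolatedVertices (E : Finset (ι × ι)) : Finset ι := {i | ∀ e ∈ E, e.1 ≠ i ∧ e.2 ≠ i}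

variable (ι) in
/-- The sets of directed edges on `ι`, without loops, that meet every vertex. They index the
expansion of the centered moments of a log-normal field. -/
def spanningEdgeSets : Finset (Finset (ι × ι)) :=
  {E ∈ Finset.univ.offDiag.powerset | isolatedVertices E = ∅}

lemma subset_offDiag_compl_iff (E : Finset (ι × ι)) (A : Finset ι) :
    E ⊆ Aᶜ.offDiag ↔ E ⊆ Finset.univ.offDiag ∧ A ⊆ isolatedVertices E := by
  simp only [isolatedVertices, Finset.subset_iff, Finset.mem_offDiag, Finset.mem_compl,
    Finset.mem_univ, Finset.mem_filter, true_and]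
  grind

lemma sum_neg_one_pow_mul_prod_offDiag {R : Type*} [CommRing R] (t : ι × ι → R) :
    ∑ A : Finset ι, (-1) ^ A.card * ∏ e ∈ Aᶜ.offDiag, (1 + t e) =
      ∑ E ∈ spanningEdgeSets ι, ∏ e ∈ E, t e := by
  have sum_signs (E : Finset (ι × ι)) :
      ∑ A ∈ (isolatedVertices E).powerset, (-1 : R) ^ A.card =
        if isolatedVertices E = ∅ then 1 else 0 := by
    exact_mod_cast congrArg (Int.cast : ℤ → R)
      (Finset.sum_powerset_neg_one_pow_card (x := isolatedVertices E))
  calc ∑ A : Finset ι, (-1) ^ A.card * ∏ e ∈ Aᶜ.offDiag, (1 + t e)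
      = ∑ A : Finset ι, ∑ E ∈ Aᶜ.offDiag.powerset, (-1) ^ A.card * ∏ e ∈ E, t e := by
        simp only [Finset.prod_one_add, Finset.mul_sum]
    _ = ∑ E ∈ Finset.univ.offDiag.powerset,
          ∑ A ∈ (isolatedVertices E).powerset, (-1) ^ A.card * ∏ e ∈ E, t e :=
        Finset.sum_comm' fun A E => by
          simp only [Finset.mem_univ, Finset.mem_powerset, true_and,
            subset_offDiag_compl_iff, and_comm]
    _ = ∑ E ∈ spanningEdgeSets ι, ∏ e ∈ E, t e := by
        simp only [← Finset.sum_mul, sum_signs, ite_mul, one_mul, zero_mul, spanningEdgeSets,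
          Finset.sum_filter]

end EdgeSets

/-- Ore's theorem: a minimal dominating set has a dominating complement, and the larger of the two
has at least half of the vertices. -/
lemma exists_card_le_two_mul_of_support_eq_univ {V : Type*} [Fintype V]
    (G : SimpleGraph V) (hG : G.support = univ) :
    ∃ L : Finset V, Fintype.card V ≤ 2 * L.card ∧ ∀ v ∈ L, ∃ w ∉ L, G.Adj v w := by
  classical
  obtain ⟨D, hD⟩ := exists_minimal_of_wellFoundedLT
    (fun D : Finset V => ∀ v ∉ D, ∃ w ∈ D, G.Adj v w) ⟨Finset.univ, by simp⟩
  have hDc : ∀ v ∈ D, ∃ w ∉ D, G.Adj v w := by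
    by_contra! ⟨v, hvD, hv⟩
    refine Finset.notMem_erase v D (hD.2 (y := D.erase v) (fun u hu => ?_) (D.erase_subset v) hvD)
    by_cases huD : u ∈ D
    · obtain rfl : u = v := by grind
      obtain ⟨w, huw⟩ : u ∈ G.support := hG ▸ mem_univ u
      exact ⟨w, Finset.mem_erase.2 ⟨huw.ne', by_contra fun hw => hv w hw huw⟩, huw⟩
    · obtain ⟨w, hwD, huw⟩ := hD.prop u huD
      exact ⟨w, Finset.mem_erase.2 ⟨fun hwv => hv u huD (hwv ▸ huw.symm), hwD⟩, huw⟩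
  rcases le_total (Fintype.card V) (2 * D.card) with hcard | hcard
  · exact ⟨D, hcard, hDc⟩
  · refine ⟨Dᶜ, ?_, fun v hv => ?_⟩
    · have := D.card_add_card_compl
      omega
    · simpa using hD.prop v (by simpa using hv)

lemma exists_domination_of_mem_spanningEdgeSets {ι : Type*} [Fintype ι] [DecidableEq ι]
    {E : Finset (ι × ι)} (hE : E ∈ spanningEdgeSets ι) :
    ∃ (L : Finset ι) (c : ι → ι), Fintype.card ι ≤ 2 * L.card ∧
      ∀ i ∈ L, c i ∉ L ∧ ((i, c i) ∈ E ∨ (c i, i) ∈ E) := by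
  classical
  rw [spanningEdgeSets, Finset.mem_filter, Finset.mem_powerset] at hE
  obtain ⟨hloop, hspan⟩ := hE
  let G := SimpleGraph.fromRel fun i j => (i, j) ∈ E
  have hG : G.support = univ := eq_univ_of_forall fun i => by
    have hi : i ∉ isolatedVertices E := hspan ▸ Finset.notMem_empty i
    simp only [isolatedVertices, Finset.mem_filter, Finset.mem_univ, true_and] at hi
    push Not at hi
    obtain ⟨e, he, hei⟩ := hi
    have hne : e.1 ≠ e.2 := (Finset.mem_offDiag.1 (hloop he)).2.2
    by_cases h1 : e.1 = i
    · exact ⟨e.2, h1 ▸ hne, Or.inl (h1 ▸ he)⟩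
    · exact ⟨e.1, hei h1 ▸ hne.symm, Or.inr (hei h1 ▸ he)⟩
  obtain ⟨L, hcard, hL⟩ := exists_card_le_two_mul_of_support_eq_univ G hG
  choose! c hc using hL
  exact ⟨L, c, hcard, fun i hi => ⟨(hc i hi).1, (hc i hi).2.2⟩⟩

lemma exists_prod_le_prod_of_mem_spanningEdgeSets {ι : Type*} [Fintype ι] [DecidableEq ι]
    {E : Finset (ι × ι)} (hE : E ∈ spanningEdgeSets ι) :
    ∃ (L : Finset ι) (c : ι → ι), Fintype.card ι ≤ 2 * L.card ∧ (∀ i ∈ L, c i ∉ L) ∧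
      ∀ w : ι → ι → ℝ, (∀ i j, 0 ≤ w i j) → (∀ i j, w i j ≤ 1) → (∀ i j, w i j = w j i) →
        ∏ e ∈ E, w e.1 e.2 ≤ ∏ i ∈ L, w i (c i) := by
  obtain ⟨L, c, hcard, hc⟩ := exists_domination_of_mem_spanningEdgeSets hE
  refine ⟨L, c, hcard, fun i hi => (hc i hi).1, fun w w_nonneg w_le_one w_symm => ?_⟩
  let edge (i : ι) : ι × ι := if (i, c i) ∈ E then (i, c i) else (c i, i)
  have edge_mem : L.image edge ⊆ E := Finset.image_subset_iff.2 fun i hi => by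
    have := hc i hi
    grind
  have edge_injOn : InjOn edge L := fun i hi j hj hij => by
    have := hc i hi
    have := hc j hj
    grind
  calc ∏ e ∈ E, w e.1 e.2
      ≤ ∏ e ∈ L.image edge, w e.1 e.2 :=
        Finset.prod_le_prod_of_subset_of_le_one edge_mem (fun _ _ => w_nonneg _ _)
          fun _ _ _ => w_le_one _ _
    _ = ∏ i ∈ L, w (edge i).1 (edge i).2 := Finset.prod_image edge_injOn
    _ = ∏ i ∈ L, w i (c i) := Finset.prod_congr rfl fun i _ => by
        by_cases h : (i, c i) ∈ E <;> simp [edge, h, w_symm]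

section DecayKernel

variable {α : Type*} [MeasurableSpace α] {μ : Measure α} {k : α → α → ℝ} {S : ℝ}

/-- Symmetric kernels with values in `[0, 1]` and marginal integrals at most `S`. -/
structure IsDecayKernel (μ : Measure α) (k : α → α → ℝ) (S : ℝ) : Prop where
  measurable : Measurable (Function.uncurry k)
  nonneg : ∀ x y, 0 ≤ k x y
  le_one : ∀ x y, k x y ≤ 1
  symm : ∀ x y, k x y = k y x
  integral_le : ∀ y, ∫ x, k x y ∂μ ≤ S

variable {ι : Type*} [Fintype ι]

lemma IsDecayKernel.integrable_prod_edges [IsFiniteMeasure μ] (hk : IsDecayKernel μ k S)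
    {J : Type*} (s : Finset J) (i j : J → ι) :
    Integrable (fun x : ι → α => ∏ e ∈ s, k (x (i e)) (x (j e))) (Measure.pi fun _ => μ) := by
  have prod_measurable : Measurable fun x : ι → α => ∏ e ∈ s, k (x (i e)) (x (j e)) :=
    Finset.measurable_fun_prod _ fun e _ =>
      hk.measurable.comp (by fun_prop : Measurable fun x : ι → α => (x (i e), x (j e)))
  refine .of_bound prod_measurable.aestronglyMeasurable 1 (ae_of_all _ fun x => ?_)
  rw [Real.norm_of_nonneg (Finset.prod_nonneg fun _ _ => hk.nonneg _ _)]
  exact Finset.prod_le_one (fun _ _ => hk.nonneg _ _) fun _ _ => hk.le_one _ _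

lemma IsDecayKernel.integral_prod_star_le [IsProbabilityMeasure μ]
    (hk : IsDecayKernel μ k S) {L : Finset ι} {c : ι → ι} (hc : ∀ i ∈ L, c i ∉ L) :
    ∫ x : ι → α, ∏ i ∈ L, k (x i) (x (c i)) ∂(Measure.pi fun _ => μ) ≤ S ^ L.card := by
  classical
  let split := MeasurableEquiv.piEquivPiSubtypeProd (fun _ : ι => α) (· ∈ L)
  have hsplit : MeasurePreserving split (Measure.pi fun _ => μ)
      ((Measure.pi fun _ => μ).prod (Measure.pi fun _ => μ)) := by
    convert measurePreserving_piEquivPiSubtypeProd (fun _ : ι => μ) (· ∈ L)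
  let stars (q : ({i // i ∈ L} → α) × ({i // i ∉ L} → α)) : ℝ :=
    ∏ i : {i // i ∈ L}, k (q.1 i) (q.2 ⟨c i, hc i i.2⟩)
  have stars_split (x : ι → α) : stars (split x) = ∏ i ∈ L, k (x i) (x (c i)) :=
    (Finset.prod_attach L fun i => k (x i) (x (c i)))
  have stars_integrable :
      Integrable stars ((Measure.pi fun _ => μ).prod (Measure.pi fun _ => μ)) := by
    rw [← hsplit.integrable_comp_emb split.measurableEmbedding]
    exact (hk.integrable_prod_edges L id c).congr (ae_of_all _ fun x => (stars_split x).symm)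
  have inner_le (y : {i // i ∉ L} → α) :
      ‖∫ x, stars (x, y) ∂(Measure.pi fun _ => μ)‖ ≤ S ^ L.card := by
    rw [integral_fintype_prod_eq_prod (fun (i : {i // i ∈ L}) x => k x (y ⟨c i, hc i i.2⟩)),
      norm_prod, ← Fintype.card_coe, ← Finset.card_univ, ← Finset.prod_const]
    refine Finset.prod_le_prod (fun _ _ => norm_nonneg _) fun i _ => ?_
    rw [Real.norm_of_nonneg (integral_nonneg fun _ => hk.nonneg _ _)]
    exact hk.integral_le _
  calc ∫ x : ι → α, ∏ i ∈ L, k (x i) (x (c i)) ∂(Measure.pi fun _ => μ)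
      = ∫ q, stars q ∂((Measure.pi fun _ => μ).prod (Measure.pi fun _ => μ)) := by
        simp only [← stars_split]
        exact hsplit.integral_comp' stars
    _ = ∫ y, ∫ x, stars (x, y) ∂(Measure.pi fun _ => μ) ∂(Measure.pi fun _ => μ) :=
        integral_prod_symm _ stars_integrable
    _ ≤ S ^ L.card := by
        simpa using (Real.le_norm_self _).trans
          (norm_integral_le_of_norm_le_const (μ := Measure.pi fun _ => μ) (ae_of_all _ inner_le))

lemma IsDecayKernel.nonneg_bound (hk : IsDecayKernel μ k S) (y : α) : 0 ≤ S :=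
  (integral_nonneg fun x => hk.nonneg x y).trans (hk.integral_le y)

lemma IsDecayKernel.integral_prod_edges_le [IsProbabilityMeasure μ] [DecidableEq ι]
    (hk : IsDecayKernel μ k S) (hS : S ≤ 1) {E : Finset (ι × ι)} (hE : E ∈ spanningEdgeSets ι) :
    ∫ x : ι → α, ∏ e ∈ E, k (x e.1) (x e.2) ∂(Measure.pi fun _ => μ) ≤
      S ^ ((Fintype.card ι + 1) / 2) := by
  obtain ⟨L, c, hcard, hc, hprod⟩ := exists_prod_le_prod_of_mem_spanningEdgeSets hE
  have hS0 : 0 ≤ S := hk.nonneg_bound μ.nonempty_of_neZero.some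
  calc ∫ x : ι → α, ∏ e ∈ E, k (x e.1) (x e.2) ∂(Measure.pi fun _ => μ)
      ≤ ∫ x : ι → α, ∏ i ∈ L, k (x i) (x (c i)) ∂(Measure.pi fun _ => μ) :=
        integral_mono (hk.integrable_prod_edges E Prod.fst Prod.snd)
          (hk.integrable_prod_edges L id c) fun x =>
            hprod (fun i j => k (x i) (x j)) (fun _ _ => hk.nonneg _ _) (fun _ _ => hk.le_one _ _)
              fun _ _ => hk.symm _ _
    _ ≤ S ^ L.card := hk.integral_prod_star_le hc
    _ ≤ S ^ ((Fintype.card ι + 1) / 2) := pow_le_pow_of_le_one hS0 hS (by omega)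

end DecayKernel

section Version

variable {Ω : Type*} [MeasurableSpace Ω] {P : Measure Ω} {G H : ℝ → Ω → ℝ} {C : ℝ → ℝ}

lemma measurable_of_continuous_of_dense {α : Type*} [TopologicalSpace α] [FrechetUrysohnSpace α]
    {F : α → Ω → ℝ} (hF : ∀ ω, Continuous fun x => F x ω) {D : Set α} (hD : Dense D)
    (hFD : ∀ x ∈ D, Measurable (F x)) (x : α) : Measurable (F x) := by
  obtain ⟨w, hwD, hw⟩ := mem_closure_iff_seq_limit.1 (hD x)
  exact measurable_of_tendsto_metrizable (fun n => hFD _ (hwD n))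
    (tendsto_pi_nhds.2 fun ω => ((hF ω).tendsto x).comp hw)

lemma exists_measurable_continuous_version {F : ℝ → Ω → ℝ}
    (hFm : ∀ x, AEMeasurable (F x) P) (hFc : ∀ᵐ ω ∂P, Continuous fun x => F x ω) :
    ∃ H : ℝ → Ω → ℝ, Measurable (Function.uncurry H) ∧ (∀ ω, Continuous fun x => H x ω) ∧
      ∀ᵐ ω ∂P, ∀ x, F x ω = H x ω := by
  classical
  have hae : ∀ᵐ ω ∂P, (Continuous fun x => F x ω) ∧ ∀ q : ℚ, F q ω = (hFm q).mk _ ω :=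
    hFc.and (ae_all_iff.2 fun q => (hFm q).ae_eq_mk)
  obtain ⟨N, hN, N_measurable, N_null⟩ := exists_measurable_superset_of_null (ae_iff.1 hae)
  have regular (ω) (hω : ω ∉ N) :
      (Continuous fun x => F x ω) ∧ ∀ q : ℚ, F q ω = (hFm q).mk _ ω :=
    by_contra fun h => hω (hN h)
  let H : ℝ → Ω → ℝ := fun x ω => if ω ∈ N then 0 else F x ω
  have H_continuous (ω) : Continuous fun x => H x ω := by
    by_cases hω : ω ∈ N
    · simpa only [H, hω, if_true] using continuous_const
    · simpa only [H, hω, if_false] using (regular ω hω).1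
  have H_rat (q : ℚ) : H q = fun ω => if ω ∈ N then 0 else (hFm q).mk _ ω := by
    funext ω
    by_cases hω : ω ∈ N
    · simp only [H, hω, if_true]
    · simp only [H, hω, if_false, (regular ω hω).2 q]
  have H_measurable := measurable_of_continuous_of_dense H_continuous Rat.denseRange_cast <| by
    rintro _ ⟨q, rfl⟩
    exact H_rat q ▸ Measurable.ite N_measurable measurable_const (hFm q).measurable_mk
  refine ⟨H, measurable_uncurry_of_continuous_of_measurable H_continuous H_measurable,
    H_continuous, ?_⟩
  filter_upwards [measure_eq_zero_iff_ae_notMem.1 N_null] with ω hω x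
  simp only [H, hω, if_false]

namespace IsStationaryGaussianField

lemma congr (hG : IsStationaryGaussianField P G C) (hGH : ∀ᵐ ω ∂P, ∀ x, G x ω = H x ω) :
    IsStationaryGaussianField P H C := by
  have hGHx (x) : G x =ᵐ[P] H x := hGH.mono fun ω h => h x
  refine ⟨hG.gaussian.congr hGHx, fun x => ?_, fun x y => ?_, ?_⟩
  · rw [← hG.mean_zero x, integral_congr_ae (hGHx x)]
  · rw [← hG.covariance_eq x y]
    simp only [covariance, integral_congr_ae (hGHx x), integral_congr_ae (hGHx y)]
    refine integral_congr_ae ?_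
    filter_upwards [hGH] with ω h
    rw [h x, h y]
  · filter_upwards [hG.continuous_paths, hGH] with ω hω h
    simpa only [← h] using hω

lemma exists_measurable_version (hG : IsStationaryGaussianField P G C) :
    ∃ H : ℝ → Ω → ℝ, Measurable (Function.uncurry H) ∧ (∀ ω, Continuous fun x => H x ω) ∧
      (∀ᵐ ω ∂P, ∀ x, G x ω = H x ω) ∧ IsStationaryGaussianField P H C := by
  obtain ⟨H, H_measurable, H_continuous, hGH⟩ :=
    exists_measurable_continuous_version hG.gaussian.aemeasurable hG.continuous_paths
  exact ⟨H, H_measurable, H_continuous, hGH, hG.congr hGH⟩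

end IsStationaryGaussianField

end Version

section Moments

variable {Ω : Type*} [MeasurableSpace Ω] {P : Measure Ω} {G : ℝ → Ω → ℝ} {C : ℝ → ℝ}

/-- The fluctuation of the inverse coefficient `exp (-G)` around its mean `exp (C 0 / 2)`. -/
noncomputable def fluct (G : ℝ → Ω → ℝ) (C : ℝ → ℝ) (x : ℝ) (ω : Ω) : ℝ :=
  Real.exp (-G x ω) - Real.exp (C 0 / 2)

lemma exp_sum_sum_div_two {ι : Type*} (A : Finset ι) (x : ι → ℝ) :
    Real.exp ((∑ i ∈ A, ∑ j ∈ A, C (x i - x j)) / 2) =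
      Real.exp (C 0 / 2) ^ A.card * ∏ e ∈ A.offDiag, Real.exp (C (x e.1 - x e.2) / 2) := by
  classical
  rw [← Finset.sum_product', ← Finset.diag_union_offDiag,
    Finset.sum_union (Finset.disjoint_diag_offDiag A), Finset.sum_diag, add_div, Real.exp_add,
    Finset.sum_div _ _ (2 : ℝ), Finset.sum_div _ _ (2 : ℝ), Real.exp_sum, Real.exp_sum]
  simp only [sub_self, Finset.prod_const]

lemma prod_exp_neg_add {ι : Type*} [Fintype ι] [DecidableEq ι] (g : ι → ℝ) (c : ℝ) :
    ∏ i, (Real.exp (-g i) + c) = ∑ A : Finset ι, c ^ A.card * Real.exp (-∑ i ∈ Aᶜ, g i) := by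
  simp only [add_comm _ c, Finset.prod_add, Finset.prod_const, Finset.powerset_univ,
    ← Finset.compl_eq_univ_sdiff, ← Finset.sum_neg_distrib, Real.exp_sum]

namespace IsStationaryGaussianField

lemma even (hG : IsStationaryGaussianField P G C) (x : ℝ) : C (-x) = C x := by
  simpa only [zero_sub, sub_zero] using
    (hG.covariance_eq 0 x).symm.trans ((covariance_comm _ _).trans (hG.covariance_eq x 0))

lemma memLp_two (hG : IsStationaryGaussianField P G C) (x : ℝ) : MemLp (G x) 2 P :=
  (hG.gaussian.hasGaussianLaw_eval x).memLp_two

lemma variance_sum (hG : IsStationaryGaussianField P G C) {ι : Type*} (s : Finset ι) (x : ι → ℝ) :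
    Var[fun ω => ∑ i ∈ s, G (x i) ω; P] = ∑ i ∈ s, ∑ j ∈ s, C (x i - x j) := by
  have := hG.gaussian.isProbabilityMeasure
  simp only [variance_fun_sum' fun i (_ : i ∈ s) => hG.memLp_two (x i), hG.covariance_eq]

lemma map_sum_eq_gaussianReal (hG : IsStationaryGaussianField P G C) {ι : Type*} (s : Finset ι)
    (x : ι → ℝ) :
    P.map (fun ω => ∑ i ∈ s, G (x i) ω) =
      gaussianReal 0 (Var[fun ω => ∑ i ∈ s, G (x i) ω; P]).toNNReal := by
  have := hG.gaussian.isProbabilityMeasure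
  have mean_zero : ∫ ω, ∑ i ∈ s, G (x i) ω ∂P = 0 := by
    rw [integral_finsetSum _ fun i _ => (hG.memLp_two (x i)).integrable one_le_two]
    exact Finset.sum_eq_zero fun i _ => hG.mean_zero (x i)
  rw [← mean_zero]
  exact ((hG.gaussian.comp_right x).hasGaussianLaw_fun_sum (I := s)).map_eq_gaussianReal

lemma integral_exp_neg_sum (hG : IsStationaryGaussianField P G C) {ι : Type*} (s : Finset ι)
    (x : ι → ℝ) :
    ∫ ω, Real.exp (-∑ i ∈ s, G (x i) ω) ∂P =
      Real.exp ((∑ i ∈ s, ∑ j ∈ s, C (x i - x j)) / 2) := by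
  have mgf_eq := mgf_gaussianReal (hG.map_sum_eq_gaussianReal s x) (-1)
  rw [Real.coe_toNNReal _ (variance_nonneg _ _), hG.variance_sum, zero_mul, zero_add, neg_one_sq,
    mul_one] at mgf_eq
  simpa only [mgf, neg_one_mul] using mgf_eq

lemma integrable_exp_neg_sum (hG : IsStationaryGaussianField P G C) {ι : Type*} (s : Finset ι)
    (x : ι → ℝ) : Integrable (fun ω => Real.exp (-∑ i ∈ s, G (x i) ω)) P :=
  not_imp_comm.1 integral_undef (hG.integral_exp_neg_sum s x ▸ (Real.exp_pos _).ne')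

variable {ι : Type*} [Fintype ι]

lemma integrable_prod_exp_neg_add (hG : IsStationaryGaussianField P G C) (c : ℝ) (x : ι → ℝ) :
    Integrable (fun ω => ∏ i, (Real.exp (-G (x i) ω) + c)) P := by
  classical
  simp only [prod_exp_neg_add]
  exact integrable_finsetSum _ fun A _ => (hG.integrable_exp_neg_sum _ x).const_mul _

lemma integrable_prod_fluct (hG : IsStationaryGaussianField P G C) (x : ι → ℝ) :
    Integrable (fun ω => ∏ i, fluct G C (x i) ω) P :=
  hG.integrable_prod_exp_neg_add (-Real.exp (C 0 / 2)) x

variable [DecidableEq ι]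

lemma integral_prod_exp_neg_add (hG : IsStationaryGaussianField P G C) (c : ℝ) (x : ι → ℝ) :
    ∫ ω, ∏ i, (Real.exp (-G (x i) ω) + c) ∂P =
      ∑ A : Finset ι, c ^ A.card * Real.exp ((∑ i ∈ Aᶜ, ∑ j ∈ Aᶜ, C (x i - x j)) / 2) := by
  simp only [prod_exp_neg_add]
  rw [integral_finsetSum _ fun A _ => (hG.integrable_exp_neg_sum _ x).const_mul _]
  simp only [integral_const_mul, hG.integral_exp_neg_sum]

lemma integral_prod_fluct (hG : IsStationaryGaussianField P G C) (x : ι → ℝ) :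
    ∫ ω, ∏ i, fluct G C (x i) ω ∂P = Real.exp (C 0 / 2) ^ Fintype.card ι *
      ∑ E ∈ spanningEdgeSets ι, ∏ e ∈ E, (Real.exp (C (x e.1 - x e.2) / 2) - 1) := by
  simp only [fluct, sub_eq_add_neg (Real.exp _) (Real.exp (C 0 / 2)),
    hG.integral_prod_exp_neg_add, exp_sum_sum_div_two]
  rw [← sum_neg_one_pow_mul_prod_offDiag, Finset.mul_sum]
  refine Finset.sum_congr rfl fun A _ => ?_
  rw [← A.card_add_card_compl, pow_add, neg_pow]
  simp only [add_sub_cancel]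
  ring

lemma integral_abs_prod_fluct_le (hG : IsStationaryGaussianField P G C) {M : ℝ}
    (hM : ∀ x, |C x| ≤ M) (x : ι → ℝ) :
    ∫ ω, |∏ i, fluct G C (x i) ω| ∂P ≤
      ∑ A : Finset ι, Real.exp (C 0 / 2) ^ A.card * Real.exp (Aᶜ.card ^ 2 * M / 2) := by
  have abs_le (ω) : |∏ i, fluct G C (x i) ω| ≤
      ∏ i, (Real.exp (-G (x i) ω) + Real.exp (C 0 / 2)) := by
    rw [Finset.abs_prod]
    refine Finset.prod_le_prod (fun _ _ => abs_nonneg _) fun i _ => ?_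
    exact (abs_sub _ _).trans_eq (by simp only [Real.abs_exp])
  refine (integral_mono (hG.integrable_prod_fluct x).abs (hG.integrable_prod_exp_neg_add _ x)
    abs_le).trans ?_
  rw [hG.integral_prod_exp_neg_add]
  gcongr with A
  calc ∑ i ∈ Aᶜ, ∑ j ∈ Aᶜ, C (x i - x j)
      ≤ ∑ _ ∈ Aᶜ, ∑ _ ∈ Aᶜ, M := by gcongr; exact (le_abs_self _).trans (hM _)
    _ = Aᶜ.card ^ 2 * M := by simp only [Finset.sum_const, nsmul_eq_mul]; ring

end IsStationaryGaussianField

end Moments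

/-- Lebesgue measure on the unit interval. -/
noncomputable abbrev unitVol : Measure ℝ := volume.restrict (Ioc 0 1)

instance : IsProbabilityMeasure unitVol := ⟨by simp [unitVol]⟩

section FluctuationIntegrals

variable {Ω : Type*} [MeasurableSpace Ω] {P : Measure Ω} {G : ℝ → Ω → ℝ} {C : ℝ → ℝ}
  {ι : Type*} [Fintype ι] {h : ι → ℝ → ℝ} {B M ε : ℝ}

lemma integrable_uncurry_of_integral_norm_le {T : Type*} [MeasurableSpace T] {τ : Measure T}
    [IsFiniteMeasure τ] [SFinite P] {F : T → Ω → ℝ} {A : ℝ} (hF : Measurable (Function.uncurry F))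
    (hFi : ∀ t, Integrable (F t) P) (hA : ∀ t, ∫ ω, |F t ω| ∂P ≤ A) :
    Integrable (Function.uncurry F) (τ.prod P) := by
  refine (integrable_prod_iff hF.aestronglyMeasurable).2 ⟨ae_of_all _ hFi, ?_⟩
  refine .of_bound hF.norm.stronglyMeasurable.integral_prod_right'.aestronglyMeasurable A
    (ae_of_all _ fun t => ?_)
  rw [Real.norm_of_nonneg (integral_nonneg fun _ => norm_nonneg _)]
  exact hA t

/-- The random variable `∫₀¹ h(x) (exp (-G(x/ε)) - E[exp (-G(x/ε))]) dx`. -/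
noncomputable def fluctInt (G : ℝ → Ω → ℝ) (C : ℝ → ℝ) (ε : ℝ) (h : ℝ → ℝ) (ω : Ω) : ℝ :=
  ∫ x, h x * fluct G C (x / ε) ω ∂unitVol

lemma measurable_fluct (hGm : Measurable (Function.uncurry G)) :
    Measurable (Function.uncurry (fluct G C)) :=
  (Real.measurable_exp.comp hGm.neg).sub_const _

lemma abs_prod_le_pow_card {g : ι → ℝ} (hg : ∀ i, |g i| ≤ B) :
    |∏ i, g i| ≤ B ^ Fintype.card ι := by
  rw [Finset.abs_prod]
  exact (Finset.prod_le_prod (fun _ _ => abs_nonneg _) fun i _ => hg i).trans_eq (by simp)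

lemma prod_fluctInt {Ω : Type*} {G : ℝ → Ω → ℝ} (ω : Ω) :
    ∏ i, fluctInt G C ε (h i) ω =
      ∫ x : ι → ℝ, ∏ i, (h i (x i) * fluct G C (x i / ε) ω) ∂(Measure.pi fun _ => unitVol) :=
  (integral_fintype_prod_eq_prod fun i x => h i x * fluct G C (x / ε) ω).symm

namespace IsStationaryGaussianField

lemma integrable_prod_mul_fluct (hG : IsStationaryGaussianField P G C)
    (hGm : Measurable (Function.uncurry G)) (hM : ∀ x, |C x| ≤ M)
    (hh : ∀ i, Measurable (h i)) (hB : ∀ i x, |h i x| ≤ B) :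
    Integrable (Function.uncurry fun (x : ι → ℝ) ω => ∏ i, (h i (x i) * fluct G C (x i / ε) ω))
      ((Measure.pi fun _ => unitVol).prod P) := by
  classical
  have := hG.gaussian.isProbabilityMeasure
  refine integrable_uncurry_of_integral_norm_le (A := B ^ Fintype.card ι *
    ∑ A : Finset ι, Real.exp (C 0 / 2) ^ A.card * Real.exp (Aᶜ.card ^ 2 * M / 2)) ?_ ?_ ?_
  · refine Finset.measurable_fun_prod _ fun i _ => ?_
    have fluct_measurable : Measurable fun q : (ι → ℝ) × Ω => fluct G C (q.1 i / ε) q.2 :=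
      (measurable_fluct hGm).comp (by fun_prop : Measurable fun q : (ι → ℝ) × Ω => (q.1 i / ε, q.2))
    have := hh i
    fun_prop
  · intro x
    simp only [Finset.prod_mul_distrib]
    exact (hG.integrable_prod_fluct _).const_mul _
  · intro x
    simp only [Finset.prod_mul_distrib, abs_mul, integral_const_mul]
    exact mul_le_mul (abs_prod_le_pow_card fun i => hB i (x i)) (hG.integral_abs_prod_fluct_le hM _)
      (integral_nonneg fun _ => abs_nonneg _)
      ((abs_nonneg _).trans (abs_prod_le_pow_card fun i => hB i (x i)))

lemma integrable_prod_fluctInt (hG : IsStationaryGaussianField P G C)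
    (hGm : Measurable (Function.uncurry G)) (hM : ∀ x, |C x| ≤ M)
    (hh : ∀ i, Measurable (h i)) (hB : ∀ i x, |h i x| ≤ B) :
    Integrable (fun ω => ∏ i, fluctInt G C ε (h i) ω) P := by
  have := hG.gaussian.isProbabilityMeasure
  simp only [prod_fluctInt]
  exact (hG.integrable_prod_mul_fluct hGm hM hh hB).integral_prod_right

lemma integral_prod_fluctInt (hG : IsStationaryGaussianField P G C)
    (hGm : Measurable (Function.uncurry G)) (hM : ∀ x, |C x| ≤ M)
    (hh : ∀ i, Measurable (h i)) (hB : ∀ i x, |h i x| ≤ B) :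
    ∫ ω, ∏ i, fluctInt G C ε (h i) ω ∂P =
      ∫ x : ι → ℝ, (∏ i, h i (x i)) * ∫ ω, ∏ i, fluct G C (x i / ε) ω ∂P
        ∂(Measure.pi fun _ => unitVol) := by
  have := hG.gaussian.isProbabilityMeasure
  simp only [prod_fluctInt]
  rw [← integral_integral_swap (hG.integrable_prod_mul_fluct hGm hM hh hB)]
  simp only [Finset.prod_mul_distrib, integral_const_mul]

lemma abs_integral_prod_fluct_le [DecidableEq ι] (hG : IsStationaryGaussianField P G C) {T : ℝ}
    {x : ι → ℝ} {w : ι → ι → ℝ} (hT : ∀ i j, |Real.exp (C (x i - x j) / 2) - 1| ≤ T * w i j) :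
    |∫ ω, ∏ i, fluct G C (x i) ω ∂P| ≤ Real.exp (C 0 / 2) ^ Fintype.card ι *
      ∑ E ∈ spanningEdgeSets ι, T ^ E.card * ∏ e ∈ E, w e.1 e.2 := by
  rw [hG.integral_prod_fluct, abs_mul, abs_of_pos (pow_pos (Real.exp_pos _) _)]
  refine mul_le_mul_of_nonneg_left ((Finset.abs_sum_le_sum_abs _ _).trans
    (Finset.sum_le_sum fun E _ => ?_)) (pow_pos (Real.exp_pos _) _).le
  rw [Finset.abs_prod, ← Finset.prod_const, ← Finset.prod_mul_distrib]
  exact Finset.prod_le_prod (fun _ _ => abs_nonneg _) fun e _ => hT e.1 e.2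

lemma abs_integral_prod_fluctInt_le [DecidableEq ι] (hG : IsStationaryGaussianField P G C)
    (hGm : Measurable (Function.uncurry G)) (hM : ∀ x, |C x| ≤ M)
    (hh : ∀ i, Measurable (h i)) (hB : ∀ i x, |h i x| ≤ B) {k : ℝ → ℝ → ℝ} {S T : ℝ}
    (hk : IsDecayKernel unitVol k S) (hS : S ≤ 1) (hT0 : 0 ≤ T)
    (hT : ∀ x y, |Real.exp (C (x / ε - y / ε) / 2) - 1| ≤ T * k x y) :
    |∫ ω, ∏ i, fluctInt G C ε (h i) ω ∂P| ≤
      B ^ Fintype.card ι * (Real.exp (C 0 / 2) ^ Fintype.card ι *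
        ∑ E ∈ spanningEdgeSets ι, T ^ E.card * S ^ ((Fintype.card ι + 1) / 2)) := by
  let bound (x : ι → ℝ) : ℝ := B ^ Fintype.card ι * (Real.exp (C 0 / 2) ^ Fintype.card ι *
    ∑ E ∈ spanningEdgeSets ι, T ^ E.card * ∏ e ∈ E, k (x e.1) (x e.2))
  have hB_pow : 0 ≤ B ^ Fintype.card ι :=
    (abs_nonneg _).trans (abs_prod_le_pow_card fun i => hB i 0)
  have edges_integrable (E : Finset (ι × ι)) : Integrable
      (fun x : ι → ℝ => T ^ E.card * ∏ e ∈ E, k (x e.1) (x e.2)) (Measure.pi fun _ => unitVol) :=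
    (hk.integrable_prod_edges E Prod.fst Prod.snd).const_mul _
  have le_bound (x : ι → ℝ) :
      ‖(∏ i, h i (x i)) * ∫ ω, ∏ i, fluct G C (x i / ε) ω ∂P‖ ≤ bound x := by
    rw [norm_mul]
    exact mul_le_mul (abs_prod_le_pow_card fun i => hB i (x i))
      (hG.abs_integral_prod_fluct_le fun i j => hT (x i) (x j)) (norm_nonneg _) hB_pow
  rw [hG.integral_prod_fluctInt hGm hM hh hB]
  refine (norm_integral_le_of_norm_le (((integrable_finsetSum _ fun E _ =>
    edges_integrable E).const_mul _).const_mul _) (ae_of_all _ le_bound)).trans ?_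
  simp only [integral_const_mul, integral_finsetSum _ fun E _ => edges_integrable E]
  gcongr with E hE
  exact hk.integral_prod_edges_le hS hE

end IsStationaryGaussianField

end FluctuationIntegrals

section FluctuationMoments

variable {Ω : Type*} [MeasurableSpace Ω] {P : Measure Ω} {G : ℝ → Ω → ℝ} {C : ℝ → ℝ}
  {h : ℝ → ℝ} {B M ε : ℝ}

namespace IsStationaryGaussianField

lemma memLp_fluctInt (hG : IsStationaryGaussianField P G C)
    (hGm : Measurable (Function.uncurry G)) (hM : ∀ x, |C x| ≤ M) (hh : Measurable h)
    (hB : ∀ x, |h x| ≤ B) : MemLp (fluctInt G C ε h) 4 P := by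
  have integrable_pow (n : ℕ) : Integrable (fun ω => fluctInt G C ε h ω ^ n) P := by
    simpa only [Fin.prod_const] using
      hG.integrable_prod_fluctInt (ε := ε) (h := fun _ : Fin n => h) hGm hM (fun _ => hh)
        fun _ => hB
  refine (integrable_norm_rpow_iff ?_ (by norm_num) (by norm_num)).1 ?_
  · simpa only [pow_one] using (integrable_pow 1).aestronglyMeasurable
  · simpa using (integrable_pow 4).norm

lemma integral_fluct (hG : IsStationaryGaussianField P G C) (x : ℝ) :
    ∫ ω, fluct G C x ω ∂P = 0 := by
  have := hG.integral_prod_fluct fun _ : Fin 1 => x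
  rw [show spanningEdgeSets (Fin 1) = ∅ by decide, Finset.sum_empty, mul_zero] at this
  simpa only [Finset.univ_unique, Finset.prod_singleton] using this

lemma integral_fluct_mul_fluct (hG : IsStationaryGaussianField P G C) (x y : ℝ) :
    ∫ ω, fluct G C x ω * fluct G C y ω ∂P = Real.exp (C 0) * (Real.exp (C (x - y)) - 1) := by
  have two_points := hG.integral_prod_fluct ![x, y]
  rw [show spanningEdgeSets (Fin 2) = {{(0, 1)}, {(1, 0)}, {(0, 1), (1, 0)}} by decide,
    Finset.sum_insert (by decide), Finset.sum_insert (by decide), Finset.sum_singleton,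
    Finset.prod_singleton, Finset.prod_singleton, Finset.prod_insert (by decide),
    Finset.prod_singleton] at two_points
  simp only [Fin.prod_univ_two, Matrix.cons_val_zero, Matrix.cons_val_one, Fintype.card_fin,
    ← hG.even (y - x), neg_sub] at two_points
  rw [two_points, ← add_halves (C 0), Real.exp_add, ← add_halves (C (x - y)), Real.exp_add]
  simp only [add_halves]
  ring

lemma integral_fluctInt (hG : IsStationaryGaussianField P G C)
    (hGm : Measurable (Function.uncurry G)) (hM : ∀ x, |C x| ≤ M) (hh : Measurable h)
    (hB : ∀ x, |h x| ≤ B) : ∫ ω, fluctInt G C ε h ω ∂P = 0 := by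
  simpa [hG.integral_fluct] using
    hG.integral_prod_fluctInt (ε := ε) (h := fun _ : Fin 1 => h) hGm hM (fun _ => hh) fun _ => hB

lemma integral_fluctInt_sq (hG : IsStationaryGaussianField P G C)
    (hGm : Measurable (Function.uncurry G)) (hM : ∀ x, |C x| ≤ M) (hh : Measurable h)
    (hB : ∀ x, |h x| ≤ B) :
    ∫ ω, fluctInt G C ε h ω ^ 2 ∂P = Real.exp (C 0) *
      ∫ p, h p.1 * h p.2 * (Real.exp (C (p.1 / ε - p.2 / ε)) - 1) ∂(unitVol.prod unitVol) := by
  have two_points := hG.integral_prod_fluctInt (ε := ε) (h := fun _ : Fin 2 => h) hGm hM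
    (fun _ => hh) fun _ => hB
  simp only [Fin.prod_univ_two, ← sq, hG.integral_fluct_mul_fluct] at two_points
  rw [two_points, ← integral_const_mul,
    ← (measurePreserving_finTwoArrow unitVol).integral_comp']
  simp only [MeasurableEquiv.finTwoArrow_apply, mul_left_comm]

end IsStationaryGaussianField

end FluctuationMoments

section QuotientPerturbation

lemma abs_div_add_le {a y m B : ℝ} (hm : 0 < m) (hmy : 0 < m + y) (hB : 1 ≤ B)
    (ha : |a| ≤ B * (m + y)) : |a / (m + y)| ≤ B / m * (|a| + |y|) := by
  rw [abs_div, abs_of_pos hmy, div_mul_eq_mul_div, div_le_div_iff₀ hmy hm]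
  calc |a| * m = |a| * (m + y) + |a| * -y := by ring
    _ ≤ |a| * (m + y) + |a| * |y| := by gcongr; exact neg_le_abs y
    _ ≤ B * |a| * (m + y) + B * (m + y) * |y| := by
        gcongr
        exact le_mul_of_one_le_left (abs_nonneg a) hB
    _ = B * (|a| + |y|) * (m + y) := by ring

lemma sq_mul_le_of_abs_le {r a y c : ℝ} (z : ℝ) (hr : |r| ≤ c * (|a| + |y|)) :
    (r * z) ^ 2 ≤ 2 * c ^ 2 * (a ^ 4 + z ^ 4 + y ^ 4) := by
  calc (r * z) ^ 2 = |r| ^ 2 * z ^ 2 := by rw [mul_pow, sq_abs]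
    _ ≤ (c * (|a| + |y|)) ^ 2 * z ^ 2 := by gcongr
    _ = c ^ 2 * ((|a| + |y|) ^ 2 * z ^ 2) := by ring
    _ ≤ c ^ 2 * (2 * (|a| ^ 2 + |y| ^ 2) * z ^ 2) := by gcongr; exact add_sq_le
    _ ≤ c ^ 2 * (2 * (a ^ 4 + z ^ 4 + y ^ 4)) := by
        gcongr c ^ 2 * ?_
        rw [sq_abs, sq_abs]
        nlinarith [sq_nonneg (a ^ 2 - z ^ 2), sq_nonneg (y ^ 2 - z ^ 2), sq_nonneg (a ^ 2),
          sq_nonneg (y ^ 2)]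
    _ = _ := by ring

lemma abs_mul_mul_mul_le_of_abs_le {r a y c : ℝ} (x z : ℝ) (hc : 0 ≤ c)
    (hr : |r| ≤ c * (|a| + |y|)) : |x * r * z * y| ≤ c * (x ^ 4 + a ^ 4 + z ^ 4 + y ^ 4) := by
  calc |x * r * z * y| = |r| * (|x| * |z| * |y|) := by simp only [abs_mul]; ring
    _ ≤ c * (|a| + |y|) * (|x| * |z| * |y|) := by gcongr
    _ = c * (|x| * |z| * (|a| * |y|) + |x| * |z| * |y| ^ 2) := by ring
    _ ≤ c * (|x| ^ 4 + |a| ^ 4 + |z| ^ 4 + |y| ^ 4) := by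
        gcongr c * ?_
        nlinarith [sq_nonneg (|x| * |z| - |a| * |y|), sq_nonneg (|x| * |z| - |y| ^ 2),
          sq_nonneg (|x| ^ 2 - |z| ^ 2), sq_nonneg (|a| ^ 2 - |y| ^ 2), sq_nonneg (|a| ^ 2),
          sq_nonneg (|y| ^ 2), sq_nonneg (|x| ^ 2), sq_nonneg (|z| ^ 2)]
    _ = _ := by simp only [(by decide : Even 4).pow_abs]

variable {Ω : Type*} [MeasurableSpace Ω] {P : Measure Ω} {X A Z Y : Ω → ℝ} {m B : ℝ}

lemma integrable_pow_four (hX : MemLp X 4 P) : Integrable (fun ω => X ω ^ 4) P := by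
  simpa only [Real.norm_eq_abs, (by decide : Even 4).pow_abs] using
    hX.integrable_norm_pow (p := 4) (by norm_num)

lemma integrable_sum_pow_four (hX : MemLp X 4 P) (hA : MemLp A 4 P) (hZ : MemLp Z 4 P)
    (hY : MemLp Y 4 P) : Integrable (fun ω => X ω ^ 4 + A ω ^ 4 + Z ω ^ 4 + Y ω ^ 4) P :=
  (((integrable_pow_four hX).add (integrable_pow_four hA)).add (integrable_pow_four hZ)).add
    (integrable_pow_four hY)

lemma memLp_div_add_mul (hm : 0 < m) (hB : 1 ≤ B) (hpos : ∀ ω, 0 < m + Y ω)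
    (hAB : ∀ ω, |A ω| ≤ B * (m + Y ω)) (hA : MemLp A 4 P) (hZ : MemLp Z 4 P) (hY : MemLp Y 4 P) :
    MemLp (fun ω => A ω / (m + Y ω) * Z ω) 2 P := by
  have aestronglyMeasurable : AEStronglyMeasurable (fun ω => A ω / (m + Y ω) * Z ω) P :=
    ((hA.aestronglyMeasurable.aemeasurable.div
      (hY.aestronglyMeasurable.aemeasurable.const_add m)).mul
      hZ.aestronglyMeasurable.aemeasurable).aestronglyMeasurable
  have integrable_bound :=
    (((integrable_pow_four hA).add (integrable_pow_four hZ)).add (integrable_pow_four hY)).const_mul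
      (2 * (B / m) ^ 2)
  refine (memLp_two_iff_integrable_sq aestronglyMeasurable).2
    (integrable_bound.mono' (aestronglyMeasurable.pow 2) (ae_of_all _ fun ω => ?_))
  rw [Real.norm_of_nonneg (sq_nonneg _)]
  exact sq_mul_le_of_abs_le _ (abs_div_add_le hm (hpos ω) hB (hAB ω))

variable [IsProbabilityMeasure P]

lemma abs_variance_sub_sub_le {R : Ω → ℝ} (hX : MemLp X 2 P) (hR : MemLp R 2 P)
    (hX0 : ∫ ω, X ω ∂P = 0) :
    |Var[X - R; P] - ∫ ω, X ω ^ 2 ∂P| ≤ 2 * |∫ ω, X ω * R ω ∂P| + ∫ ω, R ω ^ 2 ∂P := by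
  have variance_R_le := variance_le_expectation_sq (μ := P) hR.aestronglyMeasurable
  have variance_R_nonneg := variance_nonneg R P
  simp only [Pi.pow_apply] at variance_R_le
  rw [variance_sub hX hR, covariance_eq_sub hX hR, hX0, zero_mul, sub_zero,
    variance_of_integral_eq_zero hX.aestronglyMeasurable.aemeasurable hX0]
  simp only [Pi.mul_apply]
  rw [abs_le]
  constructor <;> linarith [le_abs_self (∫ ω, X ω * R ω ∂P), neg_abs_le (∫ ω, X ω * R ω ∂P)]

lemma abs_integral_mul_div_add_mul_le (hm : 0 < m) (hB : 1 ≤ B) (hpos : ∀ ω, 0 < m + Y ω)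
    (hAB : ∀ ω, |A ω| ≤ B * (m + Y ω)) (hX : MemLp X 4 P) (hA : MemLp A 4 P) (hZ : MemLp Z 4 P)
    (hY : MemLp Y 4 P) :
    |∫ ω, X ω * (A ω / (m + Y ω) * Z ω) ∂P| ≤ (|∫ ω, X ω * (A ω * Z ω) ∂P| +
      B / m * ∫ ω, X ω ^ 4 + A ω ^ 4 + Z ω ^ 4 + Y ω ^ 4 ∂P) / m := by
  have remainder_le (ω) := abs_mul_mul_mul_le_of_abs_le (X ω) (Z ω) (by positivity)
    (abs_div_add_le hm (hpos ω) hB (hAB ω))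
  have integrable_bound := (integrable_sum_pow_four hX hA hZ hY).const_mul (B / m)
  have integrable_main : Integrable (fun ω => X ω * (A ω / (m + Y ω) * Z ω)) P :=
    (hX.mono_exponent (p := 2) (by norm_num)).integrable_mul
      (memLp_div_add_mul hm hB hpos hAB hA hZ hY)
  have integrable_remainder : Integrable (fun ω => X ω * (A ω / (m + Y ω)) * Z ω * Y ω) P := by
    refine integrable_bound.mono' ?_ (ae_of_all _ remainder_le)
    simpa only [Pi.mul_def, mul_assoc] using
      integrable_main.aestronglyMeasurable.mul hY.aestronglyMeasurable
  have split : ∫ ω, X ω * (A ω * Z ω) ∂P = m * ∫ ω, X ω * (A ω / (m + Y ω) * Z ω) ∂P +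
      ∫ ω, X ω * (A ω / (m + Y ω)) * Z ω * Y ω ∂P := by
    rw [← integral_const_mul, ← integral_add (integrable_main.const_mul m) integrable_remainder]
    refine integral_congr_ae (ae_of_all _ fun ω => ?_)
    have := (hpos ω).ne'
    simp only
    field_simp
  have abs_remainder_le := abs_integral_le_integral_abs.trans
    (integral_mono integrable_remainder.abs integrable_bound remainder_le)
  rw [integral_const_mul] at abs_remainder_le
  rw [le_div_iff₀ hm]
  calc |∫ ω, X ω * (A ω / (m + Y ω) * Z ω) ∂P| * m
      = |∫ ω, X ω * (A ω * Z ω) ∂P - ∫ ω, X ω * (A ω / (m + Y ω)) * Z ω * Y ω ∂P| := by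
        rw [split, add_sub_cancel_right, abs_mul, abs_of_pos hm, mul_comm]
    _ ≤ _ := (abs_sub _ _).trans (add_le_add_right abs_remainder_le _)

lemma abs_variance_sub_div_add_mul_sub_le (hm : 0 < m) (hB : 1 ≤ B) (hpos : ∀ ω, 0 < m + Y ω)
    (hAB : ∀ ω, |A ω| ≤ B * (m + Y ω)) (hX : MemLp X 4 P) (hA : MemLp A 4 P) (hZ : MemLp Z 4 P)
    (hY : MemLp Y 4 P) (hX0 : ∫ ω, X ω ∂P = 0) :
    |Var[X - fun ω => A ω / (m + Y ω) * Z ω; P] - ∫ ω, X ω ^ 2 ∂P| ≤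
      2 / m * |∫ ω, X ω * (A ω * Z ω) ∂P| + (2 * B / m ^ 2 + 2 * (B / m) ^ 2) *
        ∫ ω, X ω ^ 4 + A ω ^ 4 + Z ω ^ 4 + Y ω ^ 4 ∂P := by
  have memLp_ratio := memLp_div_add_mul hm hB hpos hAB hA hZ hY
  have ratio_sq_le := integral_mono memLp_ratio.integrable_sq
    ((integrable_sum_pow_four hX hA hZ hY).const_mul (2 * (B / m) ^ 2)) fun ω =>
      (sq_mul_le_of_abs_le (Z ω) (abs_div_add_le hm (hpos ω) hB (hAB ω))).trans (by
        gcongr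
        exact le_add_of_nonneg_left (by positivity))
  rw [integral_const_mul] at ratio_sq_le
  refine (abs_variance_sub_sub_le (hX.mono_exponent (by norm_num)) memLp_ratio hX0).trans
    ((add_le_add (mul_le_mul_of_nonneg_left (abs_integral_mul_div_add_mul_le hm hB hpos hAB
      hX hA hZ hY) zero_le_two) ratio_sq_le).trans_eq ?_)
  field_simp
  ring

end QuotientPerturbation

section ExplicitSolution

lemma integral_unitVol (φ : ℝ → ℝ) : ∫ x, φ x ∂unitVol = ∫ x in (0 : ℝ)..1, φ x :=
  (intervalIntegral.integral_of_le zero_le_one).symm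

lemma integrable_unitVol_of_continuous {φ : ℝ → ℝ} (hφ : Continuous φ) : Integrable φ unitVol :=
  (hφ.intervalIntegrable 0 1).1

lemma integral_unitVol_pos {w : ℝ → ℝ} (hw : Continuous w) (hw0 : ∀ x, 0 < w x) :
    0 < ∫ x, w x ∂unitVol := by
  rw [integral_unitVol]
  exact intervalIntegral.intervalIntegral_pos_of_pos (hw.intervalIntegrable _ _) hw0 zero_lt_one

/-- `∫₀¹ w` times the covariance of `F` and `H` under the probability density `w / ∫₀¹ w`. For
`w = 1 / a(· / ε)` this is the averaged gradient `∫₀¹ u' g`, `F` and `H` being `f` and `g` up to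
additive constants. -/
noncomputable def weightedCov (w F H : ℝ → ℝ) : ℝ :=
  ∫ x, F x * H x * w x ∂unitVol -
    (∫ x, F x * w x ∂unitVol) / (∫ x, w x ∂unitVol) * ∫ x, H x * w x ∂unitVol

lemma weightedCov_comm (w F H : ℝ → ℝ) : weightedCov w F H = weightedCov w H F := by
  have (x : ℝ) : F x * H x = H x * F x := mul_comm _ _
  simp only [weightedCov, this, div_mul_eq_mul_div, mul_comm (∫ x, F x * w x ∂unitVol)]

lemma exists_eq_add_const_of_hasDerivAt {a f v : ℝ → ℝ} (hf : DifferentiableOn ℝ f (Ioo 0 1))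
    (hv : ∀ x ∈ Ioo (0 : ℝ) 1, HasDerivAt (fun y => a y * v y) (deriv f x) x) :
    ∃ c, ∀ x ∈ Ioo (0 : ℝ) 1, a x * v x = f x + c := by
  have hasDerivAt_sub (x) (hx : x ∈ Ioo (0 : ℝ) 1) : HasDerivAt (fun y => a y * v y - f y) 0 x := by
    have := (hv x hx).sub (hf.differentiableAt (isOpen_Ioo.mem_nhds hx)).hasDerivAt
    rwa [sub_self] at this
  obtain ⟨c, hc⟩ := isOpen_Ioo.exists_is_const_of_deriv_eq_zero isPreconnected_Ioo
    (fun x hx => (hasDerivAt_sub x hx).differentiableAt.differentiableWithinAt)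
    fun x hx => (hasDerivAt_sub x hx).deriv
  exact ⟨c, fun x hx => by rw [← hc x hx, add_sub_cancel]⟩

variable {f g u : ℝ → ℝ} {ε : ℝ}

namespace IsSolution

lemma integral_deriv {a : ℝ → ℝ} {v : ℝ → ℝ} (hu : IsSolution a ε f u) (hv : Continuous v)
    (huv : ∀ x ∈ Ioo (0 : ℝ) 1, deriv u x = v x) : ∫ x, v x ∂unitVol = 0 := by
  rw [integral_unitVol, intervalIntegral.integral_eq_sub_of_hasDerivAt_of_le zero_le_one
    hu.contDiffOn.continuousOn ?_ (hv.intervalIntegrable _ _), hu.left, hu.right, sub_zero]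
  intro x hx
  rw [← huv x hx]
  exact ((hu.contDiffOn.contDiffAt (Icc_mem_nhds hx.1 hx.2)).differentiableAt
    one_ne_zero).hasDerivAt

lemma exists_deriv_eq {w F : ℝ → ℝ} {p : ℝ} (hu : IsSolution (fun x => (w x)⁻¹) ε f u)
    (hw : ∀ x, w x ≠ 0) (hf : ContDiffOn ℝ 1 f (Icc 0 1))
    (hfF : ∀ x ∈ Icc (0 : ℝ) 1, f x = F x + p) :
    ∃ c, ∀ x ∈ Ioo (0 : ℝ) 1, deriv u x = (F x + c) * w (x / ε) := by
  obtain ⟨c, hc⟩ := exists_eq_add_const_of_hasDerivAt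
    ((hf.differentiableOn one_ne_zero).mono Ioo_subset_Icc_self) hu.equation
  refine ⟨p + c, fun x hx => ?_⟩
  rw [← add_assoc, ← hfF x (Ioo_subset_Icc_self hx), ← hc x hx, mul_right_comm,
    inv_mul_cancel₀ (hw _), one_mul]

lemma gradAverage_eq {w F H : ℝ → ℝ} {p q : ℝ} (hu : IsSolution (fun x => (w x)⁻¹) ε f u)
    (hw : Continuous w) (hw0 : ∀ x, 0 < w x) (hf : ContDiffOn ℝ 1 f (Icc 0 1)) (hF : Continuous F)
    (hH : Continuous H) (hfF : ∀ x ∈ Icc (0 : ℝ) 1, f x = F x + p)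
    (hgH : ∀ x ∈ Icc (0 : ℝ) 1, g x = H x + q) :
    gradAverage u g = weightedCov (fun x => w (x / ε)) F H := by
  obtain ⟨c, hc⟩ := hu.exists_deriv_eq (fun x => (hw0 x).ne') hf hfF
  have integrable_mul {φ : ℝ → ℝ} (hφ : Continuous φ) :
      Integrable (fun x => φ x * w (x / ε)) unitVol :=
    integrable_unitVol_of_continuous (by fun_prop)
  have mean_zero : ∫ x, (F x + c) * w (x / ε) ∂unitVol = 0 :=
    hu.integral_deriv (by fun_prop) hc
  have flux_eq : c = -((∫ x, F x * w (x / ε) ∂unitVol) / ∫ x, w (x / ε) ∂unitVol) := by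
    simp only [add_mul] at mean_zero
    rw [integral_add (integrable_mul hF) (integrable_mul continuous_const),
      integral_const_mul] at mean_zero
    rw [← neg_div, eq_div_iff (integral_unitVol_pos (by fun_prop) fun x => hw0 _).ne']
    linarith
  calc gradAverage u g
      = ∫ x, (F x + c) * (H x + q) * w (x / ε) ∂unitVol := by
        rw [gradAverage, ← integral_unitVol, unitVol, ← restrict_Ioo_eq_restrict_Ioc]
        refine setIntegral_congr_fun measurableSet_Ioo fun x hx => ?_
        simp only [hc x hx, hgH x (Ioo_subset_Icc_self hx)]
        ring
    _ = ∫ x, (F x + c) * H x * w (x / ε) + q * ((F x + c) * w (x / ε)) ∂unitVol :=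
        integral_congr_ae (ae_of_all _ fun x => by ring)
    _ = ∫ x, F x * H x * w (x / ε) + c * (H x * w (x / ε)) ∂unitVol := by
        rw [integral_add (integrable_mul (φ := fun x => (F x + c) * H x) (by fun_prop))
          ((integrable_mul (φ := fun x => F x + c) (by fun_prop)).const_mul q),
          integral_const_mul, mean_zero, mul_zero, add_zero]
        exact integral_congr_ae (ae_of_all _ fun x => by ring)
    _ = _ := by
        rw [integral_add (integrable_mul (φ := fun x => F x * H x) (by fun_prop))
          ((integrable_mul hH).const_mul c), integral_const_mul, flux_eq, neg_mul,
          ← sub_eq_add_neg, weightedCov]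

end IsSolution

end ExplicitSolution

section RescaledDecayKernel

lemma integrable_comp_of_map_le {α β : Type*} [MeasurableSpace α] [MeasurableSpace β]
    {μ : Measure α} {ν : Measure β} {T : α → β} {c : ENNReal} (hT : AEMeasurable T μ) (hc : c ≠ ⊤)
    (hμν : μ.map T ≤ c • ν) {φ : β → ℝ} (hφ : Integrable φ ν) : Integrable (fun x => φ (T x)) μ :=
  ((hφ.smul_measure hc).mono_measure hμν).comp_aemeasurable hT

lemma integral_comp_le_of_map_le {α β : Type*} [MeasurableSpace α] [MeasurableSpace β]
    {μ : Measure α} {ν : Measure β} {T : α → β} {c : ENNReal} (hT : AEMeasurable T μ) (hc : c ≠ ⊤)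
    (hμν : μ.map T ≤ c • ν) {φ : β → ℝ} (hφ : Integrable φ ν) (hφ0 : 0 ≤ᵐ[ν] φ) :
    ∫ x, φ (T x) ∂μ ≤ c.toReal * ∫ y, φ y ∂ν := by
  have hφc := hφ.smul_measure hc
  rw [← integral_map hT (hφc.mono_measure hμν).aestronglyMeasurable]
  refine (integral_mono_measure hμν ?_ hφc).trans_eq (by rw [integral_smul_measure, smul_eq_mul])
  exact Measure.ae_smul_measure hφ0 c

lemma ae_mem_unitVol : ∀ᵐ x ∂unitVol, x ∈ Ioc (0 : ℝ) 1 := ae_restrict_mem measurableSet_Ioc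

lemma map_abs_sub_unitVol_le {x : ℝ} (hx : x ∈ Icc (0 : ℝ) 1) :
    unitVol.map (fun y => |x - y|) ≤ (2 : ENNReal) • unitVol := by
  have preimage_subset (s : Set ℝ) : (fun y => |x - y|) ⁻¹' s ∩ Ioc 0 1 ⊆
      (fun y => x - y) ⁻¹' (s ∩ Icc 0 1) ∪ (fun y => y - x) ⁻¹' (s ∩ Icc 0 1) := by
    rintro y ⟨hys, hy⟩
    rcases le_total y x with hyx | hxy
    · refine Or.inl ⟨?_, sub_nonneg.2 hyx, by linarith [hx.2, hy.1]⟩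
      rwa [mem_preimage, abs_of_nonneg (sub_nonneg.2 hyx)] at hys
    · refine Or.inr ⟨?_, sub_nonneg.2 hxy, by linarith [hx.1, hy.2]⟩
      rwa [mem_preimage, abs_sub_comm, abs_of_nonneg (sub_nonneg.2 hxy)] at hys
  refine Measure.le_intro fun s hs _ => ?_
  have hs01 := hs.inter (measurableSet_Icc (a := (0 : ℝ)) (b := 1))
  have abs_sub_measurable : Measurable fun y => |x - y| := by fun_prop
  rw [Measure.map_apply abs_sub_measurable hs, Measure.smul_apply, smul_eq_mul, two_mul, unitVol,
    Measure.restrict_apply (abs_sub_measurable hs), restrict_Ioc_eq_restrict_Icc,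
    Measure.restrict_apply hs]
  calc volume ((fun y => |x - y|) ⁻¹' s ∩ Ioc 0 1) ≤ _ :=
        (measure_mono (preimage_subset s)).trans (measure_union_le _ _)
    _ = _ := by
        rw [(Measure.measurePreserving_sub_left volume x).measure_preimage hs01.nullMeasurableSet,
          (measurePreserving_sub_right volume x).measure_preimage hs01.nullMeasurableSet]

lemma map_abs_sub_unitVol_prod_le :
    (unitVol.prod unitVol).map (fun p => |p.1 - p.2|) ≤ (2 : ENNReal) • unitVol := by
  refine Measure.le_intro fun s hs _ => ?_
  have abs_sub_measurable : Measurable fun p : ℝ × ℝ => |p.1 - p.2| := by fun_prop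
  rw [Measure.map_apply abs_sub_measurable hs, Measure.prod_apply (abs_sub_measurable hs)]
  refine (lintegral_mono_ae (g := fun _ => ((2 : ENNReal) • unitVol) s)
    (ae_mem_unitVol.mono fun x hx => ?_)).trans_eq (by simp)
  have := map_abs_sub_unitVol_le (Ioc_subset_Icc_self hx) s
  rwa [Measure.map_apply (by fun_prop) hs] at this

/-- The kernel `(1 + |x - y| / ε)^{-s}`, which dominates the correlations of `G(·/ε)`. -/
noncomputable def decayKernel (s ε x y : ℝ) : ℝ := (1 + |x - y| / ε) ^ (-s)

/-- The mass `∫₀¹ (1 + z / ε)^{-s} dz` of one half of `decayKernel s ε`. -/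
noncomputable def decayMass (s ε : ℝ) : ℝ := ∫ z in (0 : ℝ)..1, (1 + z / ε) ^ (-s)

variable {s ε : ℝ}

lemma integrable_one_add_div_rpow (hε : 0 < ε) :
    Integrable (fun z => (1 + z / ε) ^ (-s)) unitVol := by
  have : ContinuousOn (fun z : ℝ => (1 + z / ε) ^ (-s)) (Icc 0 1) :=
    ContinuousOn.rpow_const (by fun_prop) fun z hz => Or.inl (by
      have := div_nonneg hz.1 hε.le
      linarith)
  exact this.integrableOn_Icc.mono_set Ioc_subset_Icc_self

lemma one_add_div_rpow_nonneg (hε : 0 < ε) : 0 ≤ᵐ[unitVol] fun z => (1 + z / ε) ^ (-s) :=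
  ae_mem_unitVol.mono fun z hz => Real.rpow_nonneg (by have := div_pos hz.1 hε; linarith) _

lemma decayMass_nonneg (hε : 0 < ε) : 0 ≤ decayMass s ε := by
  rw [decayMass, ← integral_unitVol]
  exact integral_nonneg_of_ae (one_add_div_rpow_nonneg hε)

lemma decayKernel_comm (x y : ℝ) : decayKernel s ε x y = decayKernel s ε y x := by
  rw [decayKernel, decayKernel, abs_sub_comm]

lemma decayKernel_nonneg (hε : 0 < ε) (x y : ℝ) : 0 ≤ decayKernel s ε x y := by
  rw [decayKernel]
  positivity

lemma decayKernel_le_one (hs : 0 ≤ s) (hε : 0 < ε) (x y : ℝ) : decayKernel s ε x y ≤ 1 :=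
  Real.rpow_le_one_of_one_le_of_nonpos (le_add_of_nonneg_right (by positivity)) (neg_nonpos.2 hs)

lemma decayKernel_sq (hε : 0 < ε) (x y : ℝ) :
    decayKernel s ε x y ^ 2 = decayKernel (2 * s) ε x y := by
  rw [decayKernel, decayKernel, ← Real.rpow_mul_natCast (by positivity)]
  congr 1
  push_cast
  ring

lemma integral_decayKernel_le_of_mem (hε : 0 < ε) {x : ℝ} (hx : x ∈ Icc (0 : ℝ) 1) :
    ∫ y, decayKernel s ε x y ∂unitVol ≤ 2 * decayMass s ε := by
  rw [decayMass, ← integral_unitVol]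
  exact integral_comp_le_of_map_le (by fun_prop) ENNReal.ofNat_ne_top (map_abs_sub_unitVol_le hx)
    (integrable_one_add_div_rpow hε) (one_add_div_rpow_nonneg hε)

lemma integral_prod_decayKernel_le (hε : 0 < ε) :
    ∫ p, decayKernel s ε p.1 p.2 ∂(unitVol.prod unitVol) ≤ 2 * decayMass s ε := by
  rw [decayMass, ← integral_unitVol]
  exact integral_comp_le_of_map_le (by fun_prop) ENNReal.ofNat_ne_top map_abs_sub_unitVol_prod_le
    (integrable_one_add_div_rpow hε) (one_add_div_rpow_nonneg hε)

lemma integrable_prod_decayKernel (hε : 0 < ε) :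
    Integrable (fun p : ℝ × ℝ => decayKernel s ε p.1 p.2) (unitVol.prod unitVol) :=
  integrable_comp_of_map_le (by fun_prop) ENNReal.ofNat_ne_top map_abs_sub_unitVol_prod_le
    (integrable_one_add_div_rpow hε)

lemma integrable_decayKernel (hs : 0 ≤ s) (hε : 0 < ε) (x : ℝ) :
    Integrable (decayKernel s ε x) unitVol :=
  Integrable.of_bound (by unfold decayKernel; exact Measurable.aestronglyMeasurable (by fun_prop)) 1
    (ae_of_all _ fun y => by
    rw [Real.norm_of_nonneg (decayKernel_nonneg hε x y)]
    exact decayKernel_le_one hs hε x y)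

lemma integral_decayKernel_le (hs : 0 ≤ s) (hε : 0 < ε) (x : ℝ) :
    ∫ y, decayKernel s ε x y ∂unitVol ≤ 2 * decayMass s ε := by
  refine le_trans ?_ (integral_decayKernel_le_of_mem hε (projIcc 0 1 zero_le_one x).2)
  refine integral_mono_ae (integrable_decayKernel hs hε x) (integrable_decayKernel hs hε _)
    (ae_mem_unitVol.mono fun y hy => ?_)
  have proj_le : |(projIcc 0 1 zero_le_one x : ℝ) - y| ≤ |x - y| := by
    simpa only [projIcc_of_mem zero_le_one (Ioc_subset_Icc_self hy)] using
      abs_projIcc_sub_projIcc (c := x) (d := y) (zero_le_one (α := ℝ))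
  refine Real.rpow_le_rpow_of_nonpos (by positivity) ?_ (neg_nonpos.2 hs)
  gcongr

lemma isDecayKernel_decayKernel (hs : 0 ≤ s) (hε : 0 < ε) :
    IsDecayKernel unitVol (decayKernel s ε) (min (2 * decayMass s ε) 1) where
  measurable := by unfold decayKernel Function.uncurry; fun_prop
  nonneg := decayKernel_nonneg hε
  le_one := decayKernel_le_one hs hε
  symm := decayKernel_comm
  integral_le y := by
    simp only [decayKernel_comm (y := y)]
    refine le_min (integral_decayKernel_le hs hε y) ?_
    simpa using integral_mono (integrable_decayKernel hs hε y) (integrable_const 1)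
      (decayKernel_le_one hs hε y)

lemma decayMass_eq (hε : ε ≠ 0) : decayMass s ε = ε * ∫ t in (1 : ℝ)..(1 + 1 / ε), t ^ (-s) := by
  rw [decayMass, intervalIntegral.integral_comp_add_div (fun t : ℝ => t ^ (-s)) hε, smul_eq_mul,
    zero_div, add_zero]

lemma decayMass_eq_of_ne_one (hε : 0 < ε) (hs : s ≠ 1) :
    decayMass s ε = ε * (((1 + 1 / ε) ^ (1 - s) - 1) / (1 - s)) := by
  rw [decayMass_eq hε.ne', integral_rpow, Real.one_rpow, neg_add_eq_sub]
  refine Or.inr ⟨fun h => hs (by linarith), fun h => ?_⟩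
  have : 0 < 1 / ε := by positivity
  rw [uIcc_of_le (by linarith)] at h
  linarith [h.1]

lemma decayMass_le_of_lt (hε : 0 < ε) (hε1 : ε ≤ 1) (hs0 : 0 ≤ s) (hs : s < 1) :
    decayMass s ε ≤ 2 / (1 - s) * ε ^ s := by
  have h1s : 0 < 1 - s := by linarith
  have rpow_le : (1 + 1 / ε) ^ (1 - s) ≤ 2 * (ε ^ s / ε) := by
    calc (1 + 1 / ε) ^ (1 - s) ≤ (2 / ε) ^ (1 - s) := by
          refine Real.rpow_le_rpow (by positivity) ?_ h1s.le
          rw [← one_add_one_eq_two, add_div]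
          gcongr
          exact one_le_one_div hε hε1
      _ = 2 ^ (1 - s) * (ε ^ s / ε) := by
          rw [Real.div_rpow zero_le_two hε.le, Real.rpow_sub hε, Real.rpow_one]
          field_simp
      _ ≤ 2 * (ε ^ s / ε) := by
          gcongr
          exact Real.rpow_le_self_of_one_le one_le_two (by linarith)
  calc decayMass s ε ≤ ε * ((2 * (ε ^ s / ε)) / (1 - s)) := by
        rw [decayMass_eq_of_ne_one hε hs.ne]
        gcongr
        linarith
    _ = _ := by field_simp

lemma decayMass_le_of_gt (hε : 0 < ε) (hs : 1 < s) : decayMass s ε ≤ 1 / (s - 1) * ε := by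
  have : 0 < s - 1 := by linarith
  have rpow_nonneg : 0 ≤ (1 + 1 / ε) ^ (1 - s) := by positivity
  rw [decayMass_eq_of_ne_one hε hs.ne', ← neg_div_neg_eq, neg_sub, neg_sub, mul_comm]
  gcongr
  linarith

lemma decayMass_one_le (hε : 0 < ε) (hε1 : ε ≤ 1) : decayMass 1 ε ≤ ε * (1 + |Real.log ε|) := by
  have : 0 < 1 / ε := by positivity
  have one_add_eq : 1 + 1 / ε = (1 + ε) / ε := by field_simp; ring
  rw [decayMass_eq hε.ne']
  simp only [Real.rpow_neg_one]
  rw [integral_inv_of_pos one_pos (by linarith), div_one, one_add_eq,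
    Real.log_div (by linarith) hε.ne', abs_of_nonpos (Real.log_nonpos hε.le hε1)]
  gcongr
  linarith [Real.log_le_sub_one_of_pos (by linarith : 0 < 1 + ε)]

end RescaledDecayKernel

section VarianceExpansion

lemma abs_exp_sub_sum_le (t : ℝ) (n : ℕ) :
    |Real.exp t - ∑ m ∈ Finset.range n, t ^ m / m.factorial| ≤ |t| ^ n * Real.exp |t| := by
  have := Complex.norm_exp_sub_sum_le_norm_mul_exp t n
  rw [Complex.norm_real, Real.norm_eq_abs] at this
  rw [← Real.norm_eq_abs (_ - _), ← Complex.norm_real]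
  exact_mod_cast this

lemma abs_exp_sub_sum_le_of_abs_le {t M k : ℝ} (hM : 0 ≤ M) (hk : k ≤ 1) (ht : |t| ≤ M * k)
    (n : ℕ) : |Real.exp t - ∑ m ∈ Finset.range n, t ^ m / m.factorial| ≤
      M ^ n * Real.exp M * k ^ n := by
  calc _ ≤ |t| ^ n * Real.exp |t| := abs_exp_sub_sum_le t n
    _ ≤ (M * k) ^ n * Real.exp M := by
        have := ht.trans (mul_le_of_le_one_right hM hk)
        exact mul_le_mul (pow_le_pow_left₀ (abs_nonneg t) ht n) (Real.exp_le_exp.2 this)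
          (Real.exp_pos _).le (pow_nonneg ((abs_nonneg t).trans ht) n)
    _ = _ := by ring

variable {C : ℝ → ℝ} {β M ε : ℝ}

lemma abs_cov_le_mul_decayKernel (hM : ∀ x, |C x| ≤ M * (1 + |x|) ^ (-β)) (hε : 0 < ε)
    (x y : ℝ) : |C (x / ε - y / ε)| ≤ M * decayKernel β ε x y := by
  simpa only [decayKernel, ← sub_div, abs_div, abs_of_pos hε] using hM (x / ε - y / ε)

lemma nonneg_of_abs_cov_le (hM : ∀ x, |C x| ≤ M * (1 + |x|) ^ (-β)) : 0 ≤ M := by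
  simpa using (abs_nonneg _).trans (hM 0)

lemma abs_cov_le (hβ : 0 ≤ β) (hM : ∀ x, |C x| ≤ M * (1 + |x|) ^ (-β)) (x : ℝ) : |C x| ≤ M :=
  (hM x).trans (mul_le_of_le_one_right (nonneg_of_abs_cov_le hM)
    (Real.rpow_le_one_of_one_le_of_nonpos (by simp) (neg_nonpos.2 hβ)))

lemma abs_exp_half_cov_sub_one_le (hβ : 0 ≤ β) (hM : ∀ x, |C x| ≤ M * (1 + |x|) ^ (-β))
    (hε : 0 < ε) (x y : ℝ) :
    |Real.exp (C (x / ε - y / ε) / 2) - 1| ≤ M * Real.exp M * decayKernel β ε x y := by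
  have half_le : |C (x / ε - y / ε) / 2| ≤ M * decayKernel β ε x y := by
    rw [abs_div, abs_two]
    exact (half_le_self (abs_nonneg _)).trans (abs_cov_le_mul_decayKernel hM hε x y)
  simpa using abs_exp_sub_sum_le_of_abs_le (nonneg_of_abs_cov_le hM)
    (decayKernel_le_one hβ hε x y) half_le 1

lemma abs_exp_cov_sub_one_sub_le (hβ : 0 ≤ β) (hM : ∀ x, |C x| ≤ M * (1 + |x|) ^ (-β))
    (hε : 0 < ε) (x y : ℝ) :
    |Real.exp (C (x / ε - y / ε)) - 1 - C (x / ε - y / ε)| ≤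
      M ^ 2 * Real.exp M * decayKernel (2 * β) ε x y := by
  simpa [Finset.sum_range_succ, sub_sub, decayKernel_sq hε] using
    abs_exp_sub_sum_le_of_abs_le (nonneg_of_abs_cov_le hM) (decayKernel_le_one hβ hε x y)
      (abs_cov_le_mul_decayKernel hM hε x y) 2

lemma abs_mul_le_sq_of_abs_le {h : ℝ → ℝ} {B : ℝ} (hB : ∀ x, |h x| ≤ B) (x y : ℝ) :
    |h x * h y| ≤ B ^ 2 := by
  rw [abs_mul, sq]
  exact mul_le_mul (hB x) (hB y) (abs_nonneg _) ((abs_nonneg _).trans (hB x))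

lemma abs_integral_exp_cov_sub_le (hC : Measurable C) (hβ : 0 ≤ β)
    (hM : ∀ x, |C x| ≤ M * (1 + |x|) ^ (-β)) (hε : 0 < ε) {h : ℝ → ℝ} {B : ℝ}
    (hh : Measurable h) (hB : ∀ x, |h x| ≤ B) :
    |∫ p, h p.1 * h p.2 * (Real.exp (C (p.1 / ε - p.2 / ε)) - 1) ∂(unitVol.prod unitVol)
      - ∫ p, h p.1 * h p.2 * C (p.1 / ε - p.2 / ε) ∂(unitVol.prod unitVol)| ≤
      B ^ 2 * (M ^ 2 * Real.exp M) * (2 * decayMass (2 * β) ε) := by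
  have integrable_mul {φ : ℝ → ℝ} (hφ : Measurable φ) {K : ℝ} (hK : ∀ t ∈ Icc (-M) M, |φ t| ≤ K) :
      Integrable (fun p : ℝ × ℝ => h p.1 * h p.2 * φ (C (p.1 / ε - p.2 / ε)))
        (unitVol.prod unitVol) := by
    refine Integrable.of_bound (C := B ^ 2 * K)
      (Measurable.aestronglyMeasurable (by fun_prop)) (ae_of_all _ fun p => ?_)
    rw [Real.norm_eq_abs, abs_mul]
    exact mul_le_mul (abs_mul_le_sq_of_abs_le hB _ _) (hK _ (abs_le.1 (abs_cov_le hβ hM _)))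
      (abs_nonneg _) (sq_nonneg B)
  rw [← integral_sub (integrable_mul (φ := fun t => Real.exp t - 1) (K := Real.exp M + 1)
    (by fun_prop) fun t ht => (abs_sub _ _).trans ?_)
    (integrable_mul (φ := fun t => t) (K := M) measurable_id fun t ht => abs_le.2 ht)]
  · refine abs_integral_le_integral_abs.trans ((integral_mono_of_nonneg
      (ae_of_all _ fun _ => abs_nonneg _) ((integrable_prod_decayKernel (s := 2 * β) hε).const_mul
        (B ^ 2 * (M ^ 2 * Real.exp M))) (ae_of_all _ fun p => ?_)).trans ?_)
    · simp only
      rw [← mul_sub, abs_mul, mul_assoc (B ^ 2)]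
      exact mul_le_mul (abs_mul_le_sq_of_abs_le hB _ _) (abs_exp_cov_sub_one_sub_le hβ hM hε _ _)
        (abs_nonneg _) (sq_nonneg B)
    · rw [integral_const_mul]
      gcongr
      exact integral_prod_decayKernel_le hε
  · rw [abs_one, Real.abs_exp]
    gcongr
    exact ht.2

variable {Ω : Type*} {G : ℝ → Ω → ℝ} {F H : ℝ → ℝ} {ω : Ω}

lemma integral_mul_exp_neg_eq (hω : Continuous fun x => G x ω) (C : ℝ → ℝ) {φ : ℝ → ℝ}
    (hφ : Continuous φ) : ∫ x, φ x * Real.exp (-G (x / ε) ω) ∂unitVol =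
      Real.exp (C 0 / 2) * (∫ x, φ x ∂unitVol) + fluctInt G C ε φ ω := by
  have integrable_fluct : Integrable (fun x => φ x * fluct G C (x / ε) ω) unitVol :=
    integrable_unitVol_of_continuous (by unfold fluct; fun_prop)
  rw [fluctInt, ← integral_const_mul, ← integral_add
    ((integrable_unitVol_of_continuous hφ).const_mul _) integrable_fluct]
  refine integral_congr_ae (ae_of_all _ fun x => ?_)
  simp only [fluct]
  ring

lemma integral_exp_neg_eq (hω : Continuous fun x => G x ω) (C : ℝ → ℝ) :
    ∫ x, Real.exp (-G (x / ε) ω) ∂unitVol =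
      Real.exp (C 0 / 2) + fluctInt G C ε (fun _ => 1) ω := by
  simpa using integral_mul_exp_neg_eq (ε := ε) hω C (continuous_const (y := (1 : ℝ)))

lemma exp_half_add_fluctInt_pos (hω : Continuous fun x => G x ω) :
    0 < Real.exp (C 0 / 2) + fluctInt G C ε (fun _ => 1) ω := by
  rw [← integral_exp_neg_eq hω]
  exact integral_unitVol_pos (by fun_prop) fun x => Real.exp_pos _

lemma abs_fluctInt_le_mul (hω : Continuous fun x => G x ω) (hF : Continuous F)
    (hF0 : ∫ x, F x ∂unitVol = 0) {B : ℝ} (hB : ∀ x, |F x| ≤ B) :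
    |fluctInt G C ε F ω| ≤ B * (Real.exp (C 0 / 2) + fluctInt G C ε (fun _ => 1) ω) := by
  have fluctInt_eq := integral_mul_exp_neg_eq (ε := ε) hω C hF
  rw [hF0, mul_zero, zero_add] at fluctInt_eq
  rw [← fluctInt_eq, ← integral_exp_neg_eq hω, ← integral_const_mul]
  refine abs_integral_le_integral_abs.trans (integral_mono
    (integrable_unitVol_of_continuous (by fun_prop))
    (integrable_unitVol_of_continuous (by fun_prop)) fun x => ?_)
  simp only [abs_mul, Real.abs_exp]
  exact mul_le_mul_of_nonneg_right (hB x) (Real.exp_pos _).le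

lemma weightedCov_exp_neg_eq (hGc : ∀ ω, Continuous fun x => G x ω) (C : ℝ → ℝ)
    (hF : Continuous F) (hH : Continuous H) (hF0 : ∫ x, F x ∂unitVol = 0)
    (hH0 : ∫ x, H x ∂unitVol = 0) :
    (fun ω => weightedCov (fun x => Real.exp (-G (x / ε) ω)) F H) =
      fun ω => Real.exp (C 0 / 2) * (∫ x, F x * H x ∂unitVol) +
        (fluctInt G C ε (fun x => F x * H x) - fun ω => fluctInt G C ε F ω /
          (Real.exp (C 0 / 2) + fluctInt G C ε (fun _ => 1) ω) * fluctInt G C ε H ω) ω := by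
  funext ω
  rw [weightedCov, integral_mul_exp_neg_eq (φ := fun x => F x * H x) (hGc ω) C (hF.mul hH),
    integral_mul_exp_neg_eq (hGc ω) C hF, integral_mul_exp_neg_eq (hGc ω) C hH,
    integral_exp_neg_eq (hGc ω) C, hF0, hH0]
  simp only [Pi.sub_apply]
  ring

variable [MeasurableSpace Ω] {P : Measure Ω}

namespace IsStationaryGaussianField

lemma measurable_cov (hG : IsStationaryGaussianField P G C)
    (hGm : Measurable (Function.uncurry G)) : Measurable C := by
  have := hG.gaussian.isProbabilityMeasure
  have cov_eq (x : ℝ) : C x = ∫ ω, G x ω * G 0 ω ∂P := by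
    simpa [covariance, hG.mean_zero] using (hG.covariance_eq x 0).symm
  rw [funext cov_eq]
  have : Measurable fun q : ℝ × Ω => G q.1 q.2 * G 0 q.2 :=
    hGm.mul (hGm.comp (measurable_const.prodMk measurable_snd))
  exact this.stronglyMeasurable.integral_prod_right'.measurable

lemma exists_abs_integral_prod_fluctInt_le (hG : IsStationaryGaussianField P G C)
    (hGm : Measurable (Function.uncurry G)) (hβ : 0 ≤ β)
    (hM : ∀ x, |C x| ≤ M * (1 + |x|) ^ (-β)) {ι : Type*} [Fintype ι]
    (hι : 3 ≤ Fintype.card ι) (B : ℝ) :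
    ∃ K, 0 ≤ K ∧ ∀ ε, 0 < ε → ∀ h : ι → ℝ → ℝ, (∀ i, Measurable (h i)) →
      (∀ i x, |h i x| ≤ B) →
        |∫ ω, ∏ i, fluctInt G C ε (h i) ω ∂P| ≤ K * decayMass β ε ^ 2 := by
  classical
  have hM0 := nonneg_of_abs_cov_le hM
  let edgeSum : ℝ := ∑ E ∈ spanningEdgeSets ι, (M * Real.exp M) ^ E.card
  refine ⟨|B| ^ Fintype.card ι * (Real.exp (C 0 / 2) ^ Fintype.card ι * (edgeSum * 4)),
    by positivity, fun ε hε h hh hhB => ?_⟩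
  have hk := isDecayKernel_decayKernel hβ hε
  have hS : (min (2 * decayMass β ε) 1) ^ ((Fintype.card ι + 1) / 2) ≤ 4 * decayMass β ε ^ 2 := by
    have S_nonneg : 0 ≤ min (2 * decayMass β ε) 1 :=
      le_min (mul_nonneg zero_le_two (decayMass_nonneg hε)) zero_le_one
    calc _ ≤ (min (2 * decayMass β ε) 1) ^ 2 :=
          pow_le_pow_of_le_one S_nonneg (min_le_right _ _) (by omega)
      _ ≤ (2 * decayMass β ε) ^ 2 := pow_le_pow_left₀ S_nonneg (min_le_left _ _) 2
      _ = _ := by ring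
  refine (hG.abs_integral_prod_fluctInt_le hGm (abs_cov_le hβ hM) hh
    (fun i x => (hhB i x).trans (le_abs_self B)) hk (min_le_right _ _) (by positivity)
    (abs_exp_half_cov_sub_one_le hβ hM hε)).trans ?_
  rw [← Finset.sum_mul]
  calc _ ≤ |B| ^ Fintype.card ι * (Real.exp (C 0 / 2) ^ Fintype.card ι *
        (edgeSum * (4 * decayMass β ε ^ 2))) := by gcongr
    _ = _ := by ring

lemma exists_integral_sum_fluctInt_pow_four_le (hG : IsStationaryGaussianField P G C)
    (hGm : Measurable (Function.uncurry G)) (hβ : 0 ≤ β)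
    (hM : ∀ x, |C x| ≤ M * (1 + |x|) ^ (-β)) (B : ℝ) :
    ∃ K, 0 ≤ K ∧ ∀ ε, 0 < ε → ∀ h₁ h₂ h₃ h₄ : ℝ → ℝ, Measurable h₁ → Measurable h₂ →
      Measurable h₃ → Measurable h₄ → (∀ x, |h₁ x| ≤ B) → (∀ x, |h₂ x| ≤ B) →
      (∀ x, |h₃ x| ≤ B) → (∀ x, |h₄ x| ≤ B) →
        ∫ ω, fluctInt G C ε h₁ ω ^ 4 + fluctInt G C ε h₂ ω ^ 4 + fluctInt G C ε h₃ ω ^ 4 +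
          fluctInt G C ε h₄ ω ^ 4 ∂P ≤ K * decayMass β ε ^ 2 := by
  obtain ⟨K, hK0, hK⟩ := hG.exists_abs_integral_prod_fluctInt_le hGm hβ hM (ι := Fin 4) (by simp) B
  refine ⟨4 * K, by positivity, fun ε hε h₁ h₂ h₃ h₄ hh₁ hh₂ hh₃ hh₄ hB₁ hB₂ hB₃ hB₄ => ?_⟩
  have fluctInt_pow_four_integrable {h : ℝ → ℝ} (hh : Measurable h) (hhB : ∀ x, |h x| ≤ B) :
      Integrable (fun ω => fluctInt G C ε h ω ^ 4) P :=
    integrable_pow_four (hG.memLp_fluctInt hGm (abs_cov_le hβ hM) hh hhB)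
  have integral_pow_four_le {h : ℝ → ℝ} (hh : Measurable h) (hhB : ∀ x, |h x| ≤ B) :
      ∫ ω, fluctInt G C ε h ω ^ 4 ∂P ≤ K * decayMass β ε ^ 2 := by
    simpa only [Fin.prod_const] using
      (le_abs_self _).trans (hK ε hε (fun _ => h) (fun _ => hh) fun _ => hhB)
  have i₁₂ : Integrable (fun ω => fluctInt G C ε h₁ ω ^ 4 + fluctInt G C ε h₂ ω ^ 4) P :=
    (fluctInt_pow_four_integrable hh₁ hB₁).add (fluctInt_pow_four_integrable hh₂ hB₂)
  have i₁₂₃ : Integrable (fun ω => fluctInt G C ε h₁ ω ^ 4 + fluctInt G C ε h₂ ω ^ 4 +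
      fluctInt G C ε h₃ ω ^ 4) P := i₁₂.add (fluctInt_pow_four_integrable hh₃ hB₃)
  rw [integral_add i₁₂₃ (fluctInt_pow_four_integrable hh₄ hB₄),
    integral_add i₁₂ (fluctInt_pow_four_integrable hh₃ hB₃),
    integral_add (fluctInt_pow_four_integrable hh₁ hB₁) (fluctInt_pow_four_integrable hh₂ hB₂)]
  linarith [integral_pow_four_le hh₁ hB₁, integral_pow_four_le hh₂ hB₂,
    integral_pow_four_le hh₃ hB₃, integral_pow_four_le hh₄ hB₄]

lemma exists_abs_integral_fluctInt_mul_mul_le (hG : IsStationaryGaussianField P G C)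
    (hGm : Measurable (Function.uncurry G)) (hβ : 0 ≤ β)
    (hM : ∀ x, |C x| ≤ M * (1 + |x|) ^ (-β)) (B : ℝ) :
    ∃ K, 0 ≤ K ∧ ∀ ε, 0 < ε → ∀ h₁ h₂ h₃ : ℝ → ℝ, Measurable h₁ → Measurable h₂ → Measurable h₃ →
      (∀ x, |h₁ x| ≤ B) → (∀ x, |h₂ x| ≤ B) → (∀ x, |h₃ x| ≤ B) →
        |∫ ω, fluctInt G C ε h₁ ω * (fluctInt G C ε h₂ ω * fluctInt G C ε h₃ ω) ∂P| ≤
          K * decayMass β ε ^ 2 := by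
  obtain ⟨K, hK0, hK⟩ := hG.exists_abs_integral_prod_fluctInt_le hGm hβ hM (ι := Fin 3) (by simp) B
  refine ⟨K, hK0, fun ε hε h₁ h₂ h₃ hh₁ hh₂ hh₃ hB₁ hB₂ hB₃ => ?_⟩
  simpa [Fin.prod_univ_three, mul_assoc] using hK ε hε ![h₁, h₂, h₃]
    (by simp [Fin.forall_fin_succ, hh₁, hh₂, hh₃]) (by simp [Fin.forall_fin_succ, hB₁, hB₂, hB₃])

variable {B : ℝ}

lemma memLp_fluctInt_sub_ratio (hG : IsStationaryGaussianField P G C)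
    (hGm : Measurable (Function.uncurry G)) (hGc : ∀ ω, Continuous fun x => G x ω)
    (hM : ∀ x, |C x| ≤ M) (hF : Continuous F) (hH : Continuous H)
    (hF0 : ∫ x, F x ∂unitVol = 0) (hB : 1 ≤ B) (hFB : ∀ x, |F x| ≤ B) (hHB : ∀ x, |H x| ≤ B)
    (hFHB : ∀ x, |F x * H x| ≤ B) :
    MemLp (fluctInt G C ε (fun x => F x * H x) - fun ω => fluctInt G C ε F ω /
      (Real.exp (C 0 / 2) + fluctInt G C ε (fun _ => 1) ω) * fluctInt G C ε H ω) 2 P := by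
  have := hG.gaussian.isProbabilityMeasure
  have memLp_ratio := memLp_div_add_mul (Real.exp_pos (C 0 / 2)) hB
    (fun ω => exp_half_add_fluctInt_pos (hGc ω)) (fun ω => abs_fluctInt_le_mul (hGc ω) hF hF0 hFB)
    (hG.memLp_fluctInt (ε := ε) hGm hM hF.measurable hFB)
    (hG.memLp_fluctInt (ε := ε) hGm hM hH.measurable hHB)
    (hG.memLp_fluctInt (ε := ε) hGm hM measurable_const fun _ => abs_one.trans_le hB)
  exact ((hG.memLp_fluctInt hGm hM (hF.mul hH).measurable hFHB).mono_exponent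
    (by norm_num)).sub memLp_ratio

lemma memLp_weightedCov_exp_neg (hG : IsStationaryGaussianField P G C)
    (hGm : Measurable (Function.uncurry G)) (hGc : ∀ ω, Continuous fun x => G x ω)
    (hM : ∀ x, |C x| ≤ M) (hF : Continuous F) (hH : Continuous H)
    (hF0 : ∫ x, F x ∂unitVol = 0) (hH0 : ∫ x, H x ∂unitVol = 0) (hB : 1 ≤ B)
    (hFB : ∀ x, |F x| ≤ B) (hHB : ∀ x, |H x| ≤ B) (hFHB : ∀ x, |F x * H x| ≤ B) :
    MemLp (fun ω => weightedCov (fun x => Real.exp (-G (x / ε) ω)) F H) 2 P := by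
  have := hG.gaussian.isProbabilityMeasure
  rw [weightedCov_exp_neg_eq hGc C hF hH hF0 hH0]
  exact (memLp_const (Real.exp (C 0 / 2) * ∫ x, F x * H x ∂unitVol)).add
    (hG.memLp_fluctInt_sub_ratio (ε := ε) hGm hGc hM hF hH hF0 hB hFB hHB hFHB)

lemma exists_abs_variance_weightedCov_sub_le (hG : IsStationaryGaussianField P G C)
    (hGm : Measurable (Function.uncurry G)) (hGc : ∀ ω, Continuous fun x => G x ω)
    (hβ : 0 ≤ β) (hM : ∀ x, |C x| ≤ M * (1 + |x|) ^ (-β)) (hF : Continuous F) (hH : Continuous H)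
    (hF0 : ∫ x, F x ∂unitVol = 0) (hH0 : ∫ x, H x ∂unitVol = 0) (hB : 1 ≤ B)
    (hFB : ∀ x, |F x| ≤ B) (hHB : ∀ x, |H x| ≤ B) (hFHB : ∀ x, |F x * H x| ≤ B) :
    ∃ K, 0 ≤ K ∧ ∀ ε, 0 < ε →
      |Var[fun ω => weightedCov (fun x => Real.exp (-G (x / ε) ω)) F H; P] - Real.exp (C 0) *
        ∫ p, F p.1 * H p.1 * (F p.2 * H p.2) * (Real.exp (C (p.1 / ε - p.2 / ε)) - 1)
          ∂(unitVol.prod unitVol)| ≤ K * decayMass β ε ^ 2 := by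
  have := hG.gaussian.isProbabilityMeasure
  have hM' := abs_cov_le hβ hM
  obtain ⟨K₃, hK₃, third_moment_le⟩ := hG.exists_abs_integral_fluctInt_mul_mul_le hGm hβ hM B
  obtain ⟨K₄, hK₄, integral_sum_pow_four_le⟩ :=
    hG.exists_integral_sum_fluctInt_pow_four_le hGm hβ hM B
  have hFH : Measurable fun x => F x * H x := (hF.mul hH).measurable
  have one_le (_ : ℝ) : |(1 : ℝ)| ≤ B := abs_one.trans_le hB
  refine ⟨2 / Real.exp (C 0 / 2) * K₃ + (2 * B / Real.exp (C 0 / 2) ^ 2 +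
    2 * (B / Real.exp (C 0 / 2)) ^ 2) * K₄, by positivity, fun ε hε => ?_⟩
  rw [weightedCov_exp_neg_eq hGc C hF hH hF0 hH0, variance_const_add
    (hG.memLp_fluctInt_sub_ratio hGm hGc hM' hF hH hF0 hB hFB hHB hFHB).aestronglyMeasurable,
    ← hG.integral_fluctInt_sq hGm hM' hFH hFHB]
  refine (abs_variance_sub_div_add_mul_sub_le (Real.exp_pos (C 0 / 2)) hB
    (fun ω => exp_half_add_fluctInt_pos (hGc ω)) (fun ω => abs_fluctInt_le_mul (hGc ω) hF hF0 hFB)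
    (hG.memLp_fluctInt hGm hM' hFH hFHB) (hG.memLp_fluctInt hGm hM' hF.measurable hFB)
    (hG.memLp_fluctInt hGm hM' hH.measurable hHB)
    (hG.memLp_fluctInt hGm hM' measurable_const one_le)
    (hG.integral_fluctInt hGm hM' hFH hFHB)).trans ?_
  rw [add_mul _ (_ * K₄), mul_assoc _ K₃, mul_assoc _ K₄]
  gcongr
  · exact third_moment_le ε hε _ _ _ hFH hF.measurable hH.measurable hFHB hFB hHB
  · exact integral_sum_pow_four_le ε hε _ _ _ _ hFH hF.measurable hH.measurable measurable_const
      hFHB hFB hHB one_le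

end IsStationaryGaussianField

end VarianceExpansion

section SubcriticalLeadingOrder

variable {β δ ε : ℝ} {h : ℝ → ℝ} {B : ℝ}

lemma ae_abs_sub_pos_unitVol_prod : ∀ᵐ p ∂(unitVol.prod unitVol), 0 < |p.1 - p.2| :=
  ae_of_ae_map (by fun_prop) ((Measure.absolutelyContinuous_of_le map_abs_sub_unitVol_prod_le).ae_le
    ((Measure.ae_smul_measure ae_mem_unitVol 2).mono fun _ hz => hz.1))

lemma integrable_rpow_neg_unitVol (hβ : β < 1) : Integrable (fun z : ℝ => z ^ (-β)) unitVol :=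
  (intervalIntegrable_iff_integrableOn_Ioc_of_le zero_le_one).1
    (intervalIntegral.intervalIntegrable_rpow' (by linarith))

lemma integral_rpow_neg (hβ : β < 1) (δ : ℝ) :
    ∫ z in (0 : ℝ)..δ, z ^ (-β) = δ ^ (1 - β) / (1 - β) := by
  rw [integral_rpow (Or.inl (by linarith)), neg_add_eq_sub, Real.zero_rpow (by linarith), sub_zero]

/-- The singular kernel `C̄^{sign (x - y)} |x - y|^{-β}` of the limiting quadratic form. -/
noncomputable def tailKernel (β Cplus Cminus x y : ℝ) : ℝ :=
  (if y < x then Cplus else Cminus) * |x - y| ^ (-β)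

lemma measurable_tailKernel (β Cplus Cminus : ℝ) :
    Measurable fun p : ℝ × ℝ => tailKernel β Cplus Cminus p.1 p.2 := by
  unfold tailKernel
  exact (Measurable.ite (measurableSet_lt measurable_snd measurable_fst) measurable_const
    measurable_const).mul (by fun_prop)

lemma abs_tailKernel_le (β Cplus Cminus x y : ℝ) :
    |tailKernel β Cplus Cminus x y| ≤ max |Cplus| |Cminus| * |x - y| ^ (-β) := by
  have rpow_nonneg : 0 ≤ |x - y| ^ (-β) := Real.rpow_nonneg (abs_nonneg _) _
  rw [tailKernel, abs_mul, abs_of_nonneg rpow_nonneg]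
  refine mul_le_mul_of_nonneg_right ?_ rpow_nonneg
  split_ifs
  exacts [le_max_left _ _, le_max_right _ _]

lemma integrable_mul_tailKernel (hβ : β < 1) (Cplus Cminus : ℝ) (hh : Measurable h)
    (hB : ∀ x, |h x| ≤ B) :
    Integrable (fun p : ℝ × ℝ => h p.1 * h p.2 * tailKernel β Cplus Cminus p.1 p.2)
      (unitVol.prod unitVol) := by
  have := integrable_comp_of_map_le (by fun_prop) ENNReal.ofNat_ne_top
    map_abs_sub_unitVol_prod_le (integrable_rpow_neg_unitVol hβ)
  refine (this.const_mul (B ^ 2 * max |Cplus| |Cminus|)).mono' (Measurable.aestronglyMeasurable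
    ((by fun_prop : Measurable fun p : ℝ × ℝ => h p.1 * h p.2).mul
      (measurable_tailKernel β Cplus Cminus))) (ae_of_all _ fun p => ?_)
  rw [Real.norm_eq_abs, abs_mul, mul_assoc]
  exact mul_le_mul (abs_mul_le_sq_of_abs_le hB _ _) (abs_tailKernel_le ..) (abs_nonneg _)
    (sq_nonneg B)

/-- The profile bounding the error in replacing the rescaled covariance by `tailKernel`: below the
scale `δ` the rate is only bounded by `a`, above it by `b`. -/
noncomputable def errorProfile (β δ a b z : ℝ) : ℝ :=
  a * indicator (Iic δ) (fun z => z ^ (-β)) z + b * z ^ (-β)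

lemma errorProfile_nonneg {a b z : ℝ} (ha : 0 ≤ a) (hb : 0 ≤ b) (hz : 0 ≤ z) :
    0 ≤ errorProfile β δ a b z := by
  have rpow_nonneg : 0 ≤ z ^ (-β) := Real.rpow_nonneg hz _
  refine add_nonneg (mul_nonneg ha ?_) (mul_nonneg hb rpow_nonneg)
  rw [indicator_apply]
  split_ifs
  exacts [rpow_nonneg, le_rfl]

lemma integrable_errorProfile (hβ : β < 1) (δ a b : ℝ) :
    Integrable (errorProfile β δ a b) unitVol :=
  (((integrable_rpow_neg_unitVol hβ).indicator measurableSet_Iic).const_mul a).add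
    ((integrable_rpow_neg_unitVol hβ).const_mul b)

lemma integral_errorProfile (hβ : β < 1) (hδ : δ ∈ Ioc (0 : ℝ) 1) (a b : ℝ) :
    ∫ z, errorProfile β δ a b z ∂unitVol = (a * δ ^ (1 - β) + b) / (1 - β) := by
  have rpow_integrable := integrable_rpow_neg_unitVol hβ
  unfold errorProfile
  rw [integral_add ((rpow_integrable.indicator measurableSet_Iic).const_mul a)
    (rpow_integrable.const_mul b), integral_const_mul, integral_const_mul, integral_unitVol,
    integral_unitVol, show Iic δ = {z | z ≤ δ} from rfl, intervalIntegral.integral_indicator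
      (Ioc_subset_Icc_self hδ), integral_rpow_neg hβ, integral_rpow_neg hβ, Real.one_rpow]
  ring

variable {γ C : ℝ → ℝ} {Cplus Cminus Λ M : ℝ}

lemma abs_rpow_mul_sub_mul_rpow_le_errorProfile (hγ0 : ∀ t, 0 ≤ t → 0 ≤ γ t)
    (hγΛ : ∀ t, 0 ≤ t → γ t ≤ Λ) (hmono : MonotoneOn γ (Ioi 0)) (hε : 0 < ε) (hδ : 0 < δ)
    {r c c' : ℝ} (hr : 0 < r) (hc : |(r / ε) ^ β * c - c'| ≤ γ (1 / (r / ε))) :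
    |ε ^ (-β) * c - c' * r ^ (-β)| ≤ errorProfile β δ Λ (γ (δ⁻¹ * ε)) r := by
  have rpow_pos : 0 < r ^ (-β) := Real.rpow_pos_of_pos hr _
  have factor : ε ^ (-β) * c - c' * r ^ (-β) = r ^ (-β) * ((r / ε) ^ β * c - c') := by
    rw [Real.div_rpow hr.le hε.le, Real.rpow_neg hr.le, Real.rpow_neg hε.le]
    have := (Real.rpow_pos_of_pos hr β).ne'
    field_simp
  rw [one_div_div] at hc
  rw [factor, abs_mul, abs_of_pos rpow_pos, errorProfile, indicator_apply]
  refine (mul_le_mul_of_nonneg_left hc rpow_pos.le).trans ?_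
  have hεr : 0 < ε / r := div_pos hε hr
  have hδε : 0 < δ⁻¹ * ε := by positivity
  by_cases hrδ : r ≤ δ
  · rw [if_pos (mem_Iic.2 hrδ)]
    linarith [mul_le_mul_of_nonneg_left (hγΛ _ hεr.le) rpow_pos.le,
      mul_nonneg (hγ0 _ hδε.le) rpow_pos.le]
  · rw [if_neg (mt mem_Iic.1 hrδ), mul_zero, zero_add, mul_comm]
    refine mul_le_mul_of_nonneg_right (hmono hεr hδε ?_) rpow_pos.le
    rw [div_eq_inv_mul]
    exact mul_le_mul_of_nonneg_right (inv_anti₀ hδ (not_le.1 hrδ).le) hε.le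

lemma abs_rpow_mul_cov_sub_tailKernel_le (hγ0 : ∀ t, 0 ≤ t → 0 ≤ γ t)
    (hγΛ : ∀ t, 0 ≤ t → γ t ≤ Λ) (hmono : MonotoneOn γ (Ioi 0))
    (hlim : ∀ x : ℝ, 0 < x →
      |x ^ β * C x - Cplus| ≤ γ (1 / x) ∧ |x ^ β * C (-x) - Cminus| ≤ γ (1 / x))
    (hε : 0 < ε) (hδ : 0 < δ) {x y : ℝ} (hxy : 0 < |x - y|) :
    |ε ^ (-β) * C (x / ε - y / ε) - tailKernel β Cplus Cminus x y| ≤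
      errorProfile β δ Λ (γ (δ⁻¹ * ε)) |x - y| := by
  refine abs_rpow_mul_sub_mul_rpow_le_errorProfile hγ0 hγΛ hmono hε hδ hxy ?_
  have tail_le := hlim (|x - y| / ε) (div_pos hxy hε)
  rw [← sub_div]
  by_cases hlt : y < x
  · rw [if_pos hlt]
    simpa only [abs_of_pos (sub_pos.2 hlt)] using tail_le.1
  · rw [if_neg hlt]
    simpa only [abs_of_nonpos (sub_nonpos.2 (not_lt.1 hlt)), neg_div, neg_neg] using tail_le.2

lemma abs_rpow_mul_integral_cov_sub_le (hβ : β < 1) (hC : Measurable C) (hCM : ∀ x, |C x| ≤ M)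
    (hγ0 : ∀ t, 0 ≤ t → 0 ≤ γ t) (hγΛ : ∀ t, 0 ≤ t → γ t ≤ Λ) (hmono : MonotoneOn γ (Ioi 0))
    (hlim : ∀ x : ℝ, 0 < x →
      |x ^ β * C x - Cplus| ≤ γ (1 / x) ∧ |x ^ β * C (-x) - Cminus| ≤ γ (1 / x))
    (hh : Measurable h) (hB : ∀ x, |h x| ≤ B) (hε : 0 < ε) (hδ : δ ∈ Ioc (0 : ℝ) 1) :
    |ε ^ (-β) * ∫ p, h p.1 * h p.2 * C (p.1 / ε - p.2 / ε) ∂(unitVol.prod unitVol)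
      - ∫ p, h p.1 * h p.2 * tailKernel β Cplus Cminus p.1 p.2 ∂(unitVol.prod unitVol)| ≤
      B ^ 2 * (2 * (1 + Λ) / (1 - β)) * (δ ^ (1 - β) + γ (δ⁻¹ * ε)) := by
  have : 0 < 1 - β := sub_pos.2 hβ
  have hΛ0 : 0 ≤ Λ := (hγ0 0 le_rfl).trans (hγΛ 0 le_rfl)
  have hγδ : 0 ≤ γ (δ⁻¹ * ε) := hγ0 _ (mul_nonneg (inv_nonneg.2 hδ.1.le) hε.le)
  have profile_integrable := integrable_errorProfile hβ δ Λ (γ (δ⁻¹ * ε))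
  have profile_le := integral_comp_le_of_map_le (by fun_prop) ENNReal.ofNat_ne_top
    map_abs_sub_unitVol_prod_le profile_integrable
    (ae_mem_unitVol.mono fun z hz => errorProfile_nonneg hΛ0 hγδ hz.1.le)
  rw [integral_errorProfile hβ hδ, ENNReal.toReal_ofNat] at profile_le
  have cov_integrable : Integrable (fun p : ℝ × ℝ => h p.1 * h p.2 * C (p.1 / ε - p.2 / ε))
      (unitVol.prod unitVol) :=
    Integrable.of_bound (C := B ^ 2 * M) (Measurable.aestronglyMeasurable (by fun_prop))
      (ae_of_all _ fun p => by
        rw [norm_mul]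
        exact mul_le_mul (abs_mul_le_sq_of_abs_le hB _ _) (hCM _) (norm_nonneg _) (sq_nonneg B))
  rw [← integral_const_mul, ← integral_sub (cov_integrable.const_mul _)
    (integrable_mul_tailKernel hβ Cplus Cminus hh hB)]
  calc _ ≤ ∫ p, B ^ 2 * errorProfile β δ Λ (γ (δ⁻¹ * ε)) |p.1 - p.2| ∂(unitVol.prod unitVol) := by
        rw [← Real.norm_eq_abs]
        refine norm_integral_le_of_norm_le ((integrable_comp_of_map_le (by fun_prop)
          ENNReal.ofNat_ne_top map_abs_sub_unitVol_prod_le profile_integrable).const_mul _)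
          (ae_abs_sub_pos_unitVol_prod.mono fun p hp => ?_)
        rw [mul_left_comm, ← mul_sub, norm_mul]
        exact mul_le_mul (abs_mul_le_sq_of_abs_le hB _ _) (abs_rpow_mul_cov_sub_tailKernel_le hγ0
          hγΛ hmono hlim hε hδ.1 hp) (norm_nonneg _) (sq_nonneg B)
    _ ≤ B ^ 2 * (2 * ((1 + Λ) * (δ ^ (1 - β) + γ (δ⁻¹ * ε)) / (1 - β))) := by
        rw [integral_const_mul]
        refine mul_le_mul_of_nonneg_left (profile_le.trans ?_) (sq_nonneg B)
        gcongr
        linarith [mul_nonneg hΛ0 hγδ, Real.rpow_nonneg hδ.1.le (1 - β)]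
    _ = _ := by ring

end SubcriticalLeadingOrder

section CriticalLeadingOrder

variable {h : ℝ → ℝ} {B L : ℝ}

lemma unitVol_real_sub_notMem_le (z : ℝ) : unitVol.real {x | x - z ∉ Ioc (0 : ℝ) 1} ≤ |z| := by
  have measurable : MeasurableSet {x : ℝ | x - z ∉ Ioc (0 : ℝ) 1} :=
    ((measurable_id.sub_const z) measurableSet_Ioc).compl
  have subset : {x | x - z ∉ Ioc (0 : ℝ) 1} ∩ Ioc 0 1 ⊆ Ioc 0 z ∪ Ioc (1 + z) 1 := by
    rintro x ⟨hx, hx0, hx1⟩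
    by_cases hxz : x ≤ z
    · exact Or.inl ⟨hx0, hxz⟩
    · refine Or.inr ⟨not_le.1 fun hx' => hx ⟨by linarith, by linarith⟩, hx1⟩
  rw [measureReal_restrict_apply measurable]
  refine (measureReal_mono subset (by simp)).trans ((measureReal_union_le _ _).trans ?_)
  rw [Real.volume_real_Ioc, Real.volume_real_Ioc, sub_zero, sub_add_cancel_left]
  rcases le_total 0 z with hz | hz
  · rw [max_eq_left hz, max_eq_right (neg_nonpos.2 hz), add_zero, abs_of_nonneg hz]
  · rw [max_eq_right hz, max_eq_left (neg_nonneg.2 hz), zero_add, abs_of_nonpos hz]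

/-- The autocorrelation of the restriction of `h` to the unit interval. -/
noncomputable def autocorrelation (h : ℝ → ℝ) (z : ℝ) : ℝ :=
  ∫ x, h x * indicator (Ioc 0 1) h (x - z) ∂unitVol

lemma abs_indicator_le (hB : ∀ x, |h x| ≤ B) (s : Set ℝ) (x : ℝ) : |indicator s h x| ≤ B := by
  by_cases hx : x ∈ s
  · rw [indicator_of_mem hx]
    exact hB x
  · rw [indicator_of_notMem hx, abs_zero]
    exact (abs_nonneg _).trans (hB x)

lemma abs_mul_indicator_sub_sq_le (hB : ∀ x, |h x| ≤ B) (hL : ∀ x y, |h x - h y| ≤ L * |x - y|)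
    (x z : ℝ) :
    |h x * indicator (Ioc 0 1) h (x - z) - h x ^ 2| ≤
      B * L * |z| + B ^ 2 * indicator {x | x - z ∉ Ioc (0 : ℝ) 1} 1 x := by
  have hB0 : 0 ≤ B := (abs_nonneg _).trans (hB 0)
  have increment_le : |h (x - z) - h x| ≤ L * |z| :=
    (hL _ _).trans_eq (by rw [sub_sub_cancel_left, abs_neg])
  by_cases hx : x - z ∈ Ioc (0 : ℝ) 1
  · rw [indicator_of_mem hx, indicator_of_notMem (by exact not_not.2 hx), mul_zero, add_zero, sq,
      ← mul_sub, abs_mul, mul_assoc]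
    exact mul_le_mul (hB x) increment_le (abs_nonneg _) hB0
  · rw [indicator_of_notMem hx, indicator_of_mem (by exact hx), mul_zero, zero_sub, abs_neg, sq,
      Pi.one_apply, mul_one, mul_assoc]
    exact (abs_mul_le_sq_of_abs_le hB x x).trans (le_add_of_nonneg_left
      (mul_nonneg hB0 ((abs_nonneg _).trans increment_le)))

lemma abs_autocorrelation_sub_le (hh : Measurable h) (hB : ∀ x, |h x| ≤ B)
    (hL : ∀ x y, |h x - h y| ≤ L * |x - y|) (z : ℝ) :
    |autocorrelation h z - ∫ x, h x ^ 2 ∂unitVol| ≤ (B * L + B ^ 2) * |z| := by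
  have hB0 : 0 ≤ B := (abs_nonneg _).trans (hB 0)
  have measurable_set : MeasurableSet {x : ℝ | x - z ∉ Ioc (0 : ℝ) 1} :=
    ((measurable_id.sub_const z) measurableSet_Ioc).compl
  have product_integrable : Integrable (fun x => h x * indicator (Ioc 0 1) h (x - z)) unitVol :=
    .of_bound (C := B * B) (hh.mul ((hh.indicator measurableSet_Ioc).comp
      (measurable_id.sub_const z))).aestronglyMeasurable (ae_of_all _ fun x => by
        rw [norm_mul]
        exact mul_le_mul (hB _) (abs_indicator_le hB _ _) (norm_nonneg _) hB0)
  have sq_integrable : Integrable (fun x => h x ^ 2) unitVol :=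
    .of_bound (C := B ^ 2) (hh.pow_const 2).aestronglyMeasurable (ae_of_all _ fun x => by
      rw [sq]
      exact abs_mul_le_sq_of_abs_le hB x x)
  have indicator_integrable : Integrable (fun x => B ^ 2 *
      indicator {x : ℝ | x - z ∉ Ioc (0 : ℝ) 1} 1 x) unitVol :=
    ((integrable_const (1 : ℝ)).indicator measurable_set).const_mul _
  rw [autocorrelation, ← integral_sub product_integrable sq_integrable, ← Real.norm_eq_abs]
  refine (norm_integral_le_of_norm_le ((integrable_const (B * L * |z|)).add indicator_integrable)
    (ae_of_all _ fun x => abs_mul_indicator_sub_sq_le hB hL x z)).trans ?_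
  simp only [Pi.add_apply]
  rw [integral_add (integrable_const _) indicator_integrable, integral_const, probReal_univ,
    one_smul, integral_const_mul, integral_indicator_one measurable_set, add_mul]
  gcongr
  exact unitVol_real_sub_notMem_le z

lemma integral_unitVol_mul_sub (F : ℝ → ℝ) {x : ℝ} (hx : x ∈ Ioc (0 : ℝ) 1) :
    ∫ y, h y * F (x - y) ∂unitVol =
      ∫ z in Ioc (-1) 1, indicator (Ioc 0 1) h (x - z) * F z := by
  have vanish : ∀ z ∉ Ioc (-1 : ℝ) 1, indicator (Ioc 0 1) h (x - z) * F z = 0 := fun z hz => by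
    rw [indicator_of_notMem fun hxz => hz ⟨by linarith [hxz.2, hx.1], by linarith [hxz.1, hx.2]⟩,
      zero_mul]
  rw [setIntegral_eq_integral_of_forall_compl_eq_zero vanish,
    ← integral_sub_left_eq_self _ volume x, ← integral_indicator measurableSet_Ioc]
  simp only [sub_sub_cancel, indicator_mul_left]

lemma measurable_autocorrelation (hh : Measurable h) : Measurable (autocorrelation h) :=
  ((hh.comp measurable_snd).mul ((hh.indicator measurableSet_Ioc).comp
    (measurable_snd.sub measurable_fst))).stronglyMeasurable.integral_prod_right'.measurable

lemma abs_autocorrelation_le (hB : ∀ x, |h x| ≤ B) (z : ℝ) : |autocorrelation h z| ≤ B ^ 2 := by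
  have integrand_le (x : ℝ) : ‖h x * indicator (Ioc 0 1) h (x - z)‖ ≤ B ^ 2 := by
    rw [norm_mul, sq]
    exact mul_le_mul (hB _) (abs_indicator_le hB _ _) (norm_nonneg _) ((abs_nonneg _).trans (hB 0))
  simpa [autocorrelation] using
    norm_integral_le_of_norm_le_const (μ := unitVol) (ae_of_all _ integrand_le)

lemma integral_mul_mul_sub_eq_integral_autocorrelation {F : ℝ → ℝ} {M : ℝ} (hh : Measurable h)
    (hB : ∀ x, |h x| ≤ B) (hF : Measurable F) (hM : ∀ x, |F x| ≤ M) :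
    ∫ p, h p.1 * h p.2 * F (p.1 - p.2) ∂(unitVol.prod unitVol) =
      ∫ z in Ioc (-1 : ℝ) 1, autocorrelation h z * F z := by
  have hB0 : 0 ≤ B := (abs_nonneg _).trans (hB 0)
  have square_integrable : Integrable (fun p : ℝ × ℝ => h p.1 * h p.2 * F (p.1 - p.2))
      (unitVol.prod unitVol) :=
    .of_bound (C := B ^ 2 * M) (Measurable.aestronglyMeasurable (by fun_prop))
      (ae_of_all _ fun p => by
        rw [norm_mul]
        exact mul_le_mul (abs_mul_le_sq_of_abs_le hB _ _) (hM _) (norm_nonneg _) (sq_nonneg B))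
  have strip_integrable : Integrable (Function.uncurry fun x z : ℝ =>
      h x * (indicator (Ioc 0 1) h (x - z) * F z)) (unitVol.prod (volume.restrict (Ioc (-1) 1))) :=
    .of_bound (C := B * (B * M)) (Measurable.aestronglyMeasurable ((hh.comp measurable_fst).mul
      (((hh.indicator measurableSet_Ioc).comp (measurable_fst.sub measurable_snd)).mul
      (hF.comp measurable_snd)))) (ae_of_all _ fun p => by
        rw [Function.uncurry, norm_mul, norm_mul]
        exact mul_le_mul (hB _) (mul_le_mul (abs_indicator_le hB _ _) (hM _) (norm_nonneg _) hB0)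
          (by positivity) hB0)
  calc ∫ p, h p.1 * h p.2 * F (p.1 - p.2) ∂(unitVol.prod unitVol)
      = ∫ x, (∫ z in Ioc (-1) 1, h x * (indicator (Ioc 0 1) h (x - z) * F z)) ∂unitVol := by
        rw [integral_prod _ square_integrable]
        refine integral_congr_ae (ae_mem_unitVol.mono fun x hx => ?_)
        simp only [mul_assoc, integral_const_mul, integral_unitVol_mul_sub F hx]
    _ = ∫ z in Ioc (-1) 1, autocorrelation h z * F z := by
        rw [integral_integral_swap strip_integrable]
        simp only [autocorrelation, ← integral_mul_const, mul_assoc]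

lemma abs_mul_abs_comp_div_le {C : ℝ → ℝ} {M ε : ℝ}
    (hM : ∀ x, |C x| ≤ M * (1 + |x|) ^ (-(1 : ℝ))) (hε : 0 < ε) (z : ℝ) :
    |z| * |C (z / ε)| ≤ M * ε := by
  have cov_le := hM (z / ε)
  rw [abs_div, abs_of_pos hε, Real.rpow_neg_one] at cov_le
  calc |z| * |C (z / ε)| ≤ |z| * (M * (1 + |z| / ε)⁻¹) := by gcongr
    _ = M * ε * (|z| / (ε + |z|)) := by field_simp
    _ ≤ M * ε * 1 := by
        have := nonneg_of_abs_cov_le hM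
        gcongr
        exact div_le_one_of_le₀ (by linarith) (by positivity)
    _ = M * ε := mul_one _

lemma abs_integral_cov_sub_mul_integral_le {C : ℝ → ℝ} {M ε : ℝ} (hC : Measurable C)
    (hM : ∀ x, |C x| ≤ M * (1 + |x|) ^ (-(1 : ℝ))) (hh : Measurable h) (hB : ∀ x, |h x| ≤ B)
    (hL : ∀ x y, |h x - h y| ≤ L * |x - y|) (hε : 0 < ε) :
    |∫ p, h p.1 * h p.2 * C (p.1 / ε - p.2 / ε) ∂(unitVol.prod unitVol)
      - (∫ x, h x ^ 2 ∂unitVol) * ∫ z in (-1 : ℝ)..1, C (z / ε)| ≤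
      2 * (B * L + B ^ 2) * M * ε := by
  have hCM := abs_cov_le zero_le_one hM
  have coeff_nonneg : 0 ≤ B * L + B ^ 2 := by
    simpa using (abs_nonneg _).trans (abs_autocorrelation_sub_le hh hB hL 1)
  have cov_integrable : Integrable (fun z => C (z / ε)) (volume.restrict (Ioc (-1) 1)) :=
    .of_bound (C := M) (Measurable.aestronglyMeasurable (by fun_prop)) (ae_of_all _ fun z => hCM _)
  have product_integrable : Integrable (fun z => autocorrelation h z * C (z / ε))
      (volume.restrict (Ioc (-1) 1)) :=
    cov_integrable.bdd_mul (measurable_autocorrelation hh).aestronglyMeasurable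
      (ae_of_all _ fun z => abs_autocorrelation_le hB z)
  have volume_strip : (volume.restrict (Ioc (-1 : ℝ) 1)).real univ = 2 := by
    rw [measureReal_restrict_apply MeasurableSet.univ, univ_inter,
      Real.volume_real_Ioc_of_le (by norm_num)]
    norm_num
  simp only [← sub_div]
  rw [integral_mul_mul_sub_eq_integral_autocorrelation (F := fun x => C (x / ε)) hh hB
    (hC.comp (measurable_id.div_const ε)) fun x => hCM _,
    intervalIntegral.integral_of_le (by norm_num), ← integral_const_mul,
    ← integral_sub product_integrable (cov_integrable.const_mul _), ← Real.norm_eq_abs]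
  refine (norm_integral_le_of_norm_le_const (C := (B * L + B ^ 2) * (M * ε))
    (ae_of_all _ fun z => ?_)).trans_eq (by rw [volume_strip]; ring)
  calc _ ≤ (B * L + B ^ 2) * |z| * |C (z / ε)| := by
        rw [← sub_mul, norm_mul]
        exact mul_le_mul_of_nonneg_right (abs_autocorrelation_sub_le hh hB hL z) (abs_nonneg _)
    _ ≤ (B * L + B ^ 2) * (M * ε) := by
        rw [mul_assoc]
        exact mul_le_mul_of_nonneg_left (abs_mul_abs_comp_div_le hM hε z) coeff_nonneg

end CriticalLeadingOrder

section Rates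

variable {β ε : ℝ} {γ : ℝ → ℝ}

lemma infTerm_nonneg (hγ0 : ∀ t, 0 ≤ t → 0 ≤ γ t) (hε : 0 < ε) : 0 ≤ infTerm β γ ε := by
  refine Real.sInf_nonneg ?_
  rintro _ ⟨δ, hδ, rfl⟩
  exact add_nonneg (Real.rpow_nonneg hδ.1.le _)
    (hγ0 _ (mul_nonneg (inv_nonneg.2 hδ.1.le) hε.le))

lemma le_mul_infTerm {a K : ℝ} (hK : 0 < K)
    (h : ∀ δ ∈ Ioc (0 : ℝ) 1, a ≤ K * (δ ^ (1 - β) + γ (δ⁻¹ * ε))) : a ≤ K * infTerm β γ ε := by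
  rw [← div_le_iff₀' hK]
  refine le_csInf ⟨_, 1, ⟨one_pos, le_rfl⟩, rfl⟩ ?_
  rintro _ ⟨δ, hδ, rfl⟩
  rw [div_le_iff₀' hK]
  exact h δ hδ

lemma HolderAtZero.continuousAt {C : ℝ → ℝ} (hC : HolderAtZero C) : ContinuousAt C 0 := by
  obtain ⟨α, M, r, hα, hr, hM⟩ := hC
  have bound_tendsto : Tendsto (fun x : ℝ => M * |x| ^ α) (𝓝 0) (𝓝 0) := by
    have : ContinuousAt (fun x : ℝ => M * |x| ^ α) 0 :=
      continuousAt_const.mul (continuous_abs.continuousAt.rpow_const (Or.inr hα.le))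
    simpa [ContinuousAt, Real.zero_rpow hα.ne'] using this
  refine tendsto_iff_norm_sub_tendsto_zero.2
    (squeeze_zero' (.of_forall fun _ => norm_nonneg _) ?_ bound_tendsto)
  filter_upwards [Metric.closedBall_mem_nhds (0 : ℝ) hr] with x hx
  exact hM x (by simpa using hx)

lemma apply_zero_eq_zero_of_rpow_mul_eq (hβ : 0 < β) {C : ℝ → ℝ} {c : ℝ} (hC : ContinuousAt C 0)
    (h : ∀ x, 0 < x → x ^ β * C x = c) : C 0 = 0 := by
  have product_tendsto : Tendsto (fun x : ℝ => x ^ β * C x) (𝓝[>] 0) (𝓝 0) := by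
    have : ContinuousAt (fun x : ℝ => x ^ β * C x) 0 :=
      (Real.continuousAt_rpow_const 0 β (Or.inr hβ.le)).mul hC
    simpa [ContinuousAt, Real.zero_rpow hβ.ne'] using this.tendsto.mono_left nhdsWithin_le_nhds
  have c_eq_zero : c = 0 := tendsto_nhds_unique tendsto_const_nhds
    (product_tendsto.congr' ((eventually_mem_nhdsWithin (s := Ioi 0)).mono h))
  refine tendsto_nhds_unique (hC.tendsto.mono_left nhdsWithin_le_nhds)
    ((tendsto_const_nhds (f := 𝓝[>] (0 : ℝ))).congr' ?_)
  filter_upwards [self_mem_nhdsWithin] with x hx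
  exact ((mul_eq_zero.1 ((h x hx).trans c_eq_zero)).resolve_left
    (Real.rpow_pos_of_pos hx β).ne').symm

/- An identically vanishing rate would force `C x = c x ^ (-β)` near the origin, which is
incompatible with continuity and `C 0 ≠ 0`. -/
lemma exists_rate_pos (hβ : 0 < β) {C : ℝ → ℝ} {c : ℝ} (hC : ContinuousAt C 0) (hC0 : C 0 ≠ 0)
    (hlim : ∀ x : ℝ, 0 < x → |x ^ β * C x - c| ≤ γ (1 / x)) : ∃ t, 0 < t ∧ 0 < γ t := by
  contrapose! hC0
  exact apply_zero_eq_zero_of_rpow_mul_eq (c := c) hβ hC fun x hx => sub_eq_zero.1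
    (abs_nonpos_iff.1 ((hlim x hx).trans (hC0 _ (one_div_pos.2 hx))))

lemma exists_rpow_le_mul_infTerm (hβ : β < 1) (hγ0 : ∀ t, 0 ≤ t → 0 ≤ γ t)
    (hmono : MonotoneOn γ (Ioi 0)) (hpos : ∃ t, 0 < t ∧ 0 < γ t) :
    ∃ K, 0 ≤ K ∧ ∀ ε ∈ Ioo (0 : ℝ) 1, ε ^ (1 - β) ≤ K * infTerm β γ ε := by
  obtain ⟨t, ht, hγt⟩ := hpos
  have h1β : 0 ≤ 1 - β := (sub_pos.2 hβ).le
  have ht_rpow : 0 < t ^ (1 - β) := Real.rpow_pos_of_pos ht _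
  refine ⟨(γ t)⁻¹ + t ^ (1 - β), by positivity, fun ε hε => ?_⟩
  refine le_mul_infTerm (by positivity) fun δ hδ => ?_
  have hδ_rpow : 0 ≤ δ ^ (1 - β) := Real.rpow_nonneg hδ.1.le _
  have hγδ := hγ0 (δ⁻¹ * ε) (mul_nonneg (inv_nonneg.2 hδ.1.le) hε.1.le)
  rcases le_total t (δ⁻¹ * ε) with h | h
  · calc ε ^ (1 - β) ≤ 1 := Real.rpow_le_one hε.1.le hε.2.le h1β
      _ ≤ (γ t)⁻¹ * γ (δ⁻¹ * ε) := by
          rw [inv_mul_eq_div, one_le_div hγt]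
          exact hmono ht (ht.trans_le h) h
      _ ≤ _ := by gcongr <;> linarith
  · have hεδ : ε ≤ t * δ := by rwa [inv_mul_eq_div, div_le_iff₀ hδ.1] at h
    calc ε ^ (1 - β) ≤ t ^ (1 - β) * δ ^ (1 - β) := by
          rw [← Real.mul_rpow ht.le hδ.1.le]
          exact Real.rpow_le_rpow hε.1.le hεδ h1β
      _ ≤ _ := by
          gcongr
          · linarith [inv_pos.2 hγt]
          · linarith

lemma infTerm_le_PiRate (hβ : β < 1) (hε : 0 < ε) : infTerm β γ ε ≤ PiRate β γ ε := by
  rw [PiRate, if_neg hβ.ne]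
  split_ifs
  · exact le_add_of_nonneg_left (mul_nonneg (Real.rpow_nonneg hε.le _) (abs_nonneg _))
  · exact le_add_of_nonneg_left (Real.rpow_nonneg hε.le _)

lemma rpow_min_le_PiRate (hβ1 : β < 1) (hβ : β ≠ 1 / 2) (hγ0 : ∀ t, 0 ≤ t → 0 ≤ γ t)
    (hε : 0 < ε) : ε ^ min β (1 - β) ≤ PiRate β γ ε := by
  rw [PiRate, if_neg hβ1.ne, if_neg hβ]
  exact le_add_of_nonneg_right (infTerm_nonneg hγ0 hε)

lemma exists_rpow_half_mul_le_PiRate (hγ0 : ∀ t, 0 ≤ t → 0 ≤ γ t)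
    (hmono : MonotoneOn γ (Ioi 0)) (hpos : ∃ t, 0 < t ∧ 0 < γ t) :
    ∃ K, 0 ≤ K ∧ ∀ ε ∈ Ioo (0 : ℝ) 1,
      ε ^ (1 / 2 : ℝ) * (1 + |Real.log ε|) ≤ K * PiRate (1 / 2) γ ε := by
  obtain ⟨K, hK, rpow_le⟩ := exists_rpow_le_mul_infTerm one_half_lt_one hγ0 hmono hpos
  refine ⟨1 + K, by positivity, fun ε hε => ?_⟩
  have rpow_le := rpow_le ε hε
  rw [sub_half] at rpow_le
  have infTerm_nonneg := infTerm_nonneg (β := 1 / 2) hγ0 hε.1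
  have log_nonneg : 0 ≤ ε ^ (1 / 2 : ℝ) * |Real.log ε| :=
    mul_nonneg (Real.rpow_nonneg hε.1.le _) (abs_nonneg _)
  rw [PiRate, if_neg one_half_lt_one.ne, if_pos rfl]
  linarith [mul_nonneg hK log_nonneg]

lemma exists_rpow_le_PiRate (hβ : β < 1) (hγ0 : ∀ t, 0 ≤ t → 0 ≤ γ t)
    (hmono : MonotoneOn γ (Ioi 0)) (hpos : ∃ t, 0 < t ∧ 0 < γ t) :
    ∃ K, 0 ≤ K ∧ ∀ ε ∈ Ioo (0 : ℝ) 1, ε ^ β ≤ K * PiRate β γ ε := by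
  rcases eq_or_ne β (1 / 2) with rfl | hβ'
  · obtain ⟨K, hK, log_le⟩ := exists_rpow_half_mul_le_PiRate hγ0 hmono hpos
    exact ⟨K, hK, fun ε hε => (le_mul_of_one_le_right (Real.rpow_nonneg hε.1.le _)
      (le_add_of_nonneg_right (abs_nonneg _))).trans (log_le ε hε)⟩
  · refine ⟨1, zero_le_one, fun ε hε => ?_⟩
    rw [one_mul]
    exact (Real.rpow_le_rpow_of_exponent_ge hε.1 hε.2.le (min_le_left _ _)).trans
      (rpow_min_le_PiRate hβ hβ' hγ0 hε.1)

lemma exists_rpow_neg_mul_decayMass_two_mul_le (hβ0 : 0 ≤ β) (hβ1 : β < 1)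
    (hγ0 : ∀ t, 0 ≤ t → 0 ≤ γ t) (hmono : MonotoneOn γ (Ioi 0)) (hpos : ∃ t, 0 < t ∧ 0 < γ t) :
    ∃ K, 0 ≤ K ∧ ∀ ε ∈ Ioo (0 : ℝ) 1, ε ^ (-β) * decayMass (2 * β) ε ≤ K * PiRate β γ ε := by
  rcases lt_trichotomy β (1 / 2) with hβ | rfl | hβ
  · have h2β : 0 < 1 - 2 * β := by linarith
    refine ⟨2 / (1 - 2 * β), by positivity, fun ε hε => ?_⟩
    have min_rpow_le := rpow_min_le_PiRate (ε := ε) hβ1 hβ.ne hγ0 hε.1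
    rw [min_eq_left (by linarith)] at min_rpow_le
    calc _ ≤ ε ^ (-β) * (2 / (1 - 2 * β) * ε ^ (2 * β)) := mul_le_mul_of_nonneg_left
          (decayMass_le_of_lt hε.1 hε.2.le (by linarith) (by linarith))
          (Real.rpow_nonneg hε.1.le _)
      _ = 2 / (1 - 2 * β) * ε ^ β := by
          rw [mul_left_comm, ← Real.rpow_add hε.1, neg_add_eq_sub, two_mul, add_sub_cancel_right]
      _ ≤ _ := by gcongr
  · obtain ⟨K, hK, log_le⟩ := exists_rpow_half_mul_le_PiRate hγ0 hmono hpos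
    refine ⟨K, hK, fun ε hε => le_trans ?_ (log_le ε hε)⟩
    calc _ ≤ ε ^ (-(1 / 2) : ℝ) * (ε * (1 + |Real.log ε|)) := by
          rw [mul_one_div_cancel two_ne_zero]
          exact mul_le_mul_of_nonneg_left (decayMass_one_le hε.1 hε.2.le)
            (Real.rpow_nonneg hε.1.le _)
      _ = ε ^ (1 / 2 : ℝ) * (1 + |Real.log ε|) := by
          rw [← mul_assoc, ← Real.rpow_add_one hε.1.ne']
          norm_num
  · have h2β : 0 < 2 * β - 1 := by linarith
    refine ⟨1 / (2 * β - 1), by positivity, fun ε hε => ?_⟩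
    have min_rpow_le := rpow_min_le_PiRate (ε := ε) hβ1 hβ.ne' hγ0 hε.1
    rw [min_eq_right (by linarith)] at min_rpow_le
    calc _ ≤ ε ^ (-β) * (1 / (2 * β - 1) * ε) := mul_le_mul_of_nonneg_left
          (decayMass_le_of_gt hε.1 (by linarith)) (Real.rpow_nonneg hε.1.le _)
      _ = 1 / (2 * β - 1) * ε ^ (1 - β) := by
          rw [mul_left_comm, ← Real.rpow_add_one hε.1.ne', neg_add_eq_sub]
      _ ≤ _ := by gcongr

lemma rpow_neg_mul_decayMass_sq_le (hβ0 : 0 ≤ β) (hβ1 : β < 1) (hε : 0 < ε) (hε1 : ε ≤ 1) :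
    ε ^ (-β) * decayMass β ε ^ 2 ≤ (2 / (1 - β)) ^ 2 * ε ^ β :=
  calc _ ≤ ε ^ (-β) * (2 / (1 - β) * ε ^ β) ^ 2 := mul_le_mul_of_nonneg_left
        (pow_le_pow_left₀ (decayMass_nonneg hε) (decayMass_le_of_lt hε hε1 hβ0 hβ1) 2)
        (Real.rpow_nonneg hε.le _)
    _ = (2 / (1 - β)) ^ 2 * (ε ^ (-β) * ε ^ β * ε ^ β) := by ring
    _ = _ := by rw [← Real.rpow_add hε, neg_add_cancel, Real.rpow_zero, one_mul]

lemma exists_rpow_neg_mul_decayMass_add_le (hβ0 : 0 ≤ β) (hβ1 : β < 1)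
    (hγ0 : ∀ t, 0 ≤ t → 0 ≤ γ t) (hmono : MonotoneOn γ (Ioi 0)) (hpos : ∃ t, 0 < t ∧ 0 < γ t) :
    ∃ K, 0 ≤ K ∧ ∀ ε ∈ Ioo (0 : ℝ) 1,
      ε ^ (-β) * (decayMass β ε ^ 2 + decayMass (2 * β) ε) ≤ K * PiRate β γ ε := by
  obtain ⟨K₁, hK₁, rpow_le⟩ := exists_rpow_le_PiRate hβ1 hγ0 hmono hpos
  obtain ⟨K₂, hK₂, decayMass_le⟩ :=
    exists_rpow_neg_mul_decayMass_two_mul_le hβ0 hβ1 hγ0 hmono hpos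
  refine ⟨(2 / (1 - β)) ^ 2 * K₁ + K₂, by positivity, fun ε hε => ?_⟩
  rw [mul_add, add_mul, mul_assoc]
  exact add_le_add ((rpow_neg_mul_decayMass_sq_le hβ0 hβ1 hε.1 hε.2.le).trans
    (mul_le_mul_of_nonneg_left (rpow_le ε hε) (sq_nonneg _))) (decayMass_le ε hε)

lemma mul_one_add_abs_log_sq_le (hε : ε ∈ Ioo (0 : ℝ) 1) : ε * (1 + |Real.log ε|) ^ 2 ≤ 4 := by
  have abs_log : |Real.log ε| = -Real.log ε := abs_of_neg (Real.log_neg hε.1 hε.2)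
  have one_add_le : 1 + |Real.log ε| ≤ 2 * Real.exp (-Real.log ε / 2) := by
    linarith [Real.add_one_le_exp (-Real.log ε / 2)]
  calc ε * (1 + |Real.log ε|) ^ 2 ≤ ε * (2 * Real.exp (-Real.log ε / 2)) ^ 2 := by
        have := hε.1
        gcongr
    _ = 4 * (ε * Real.exp (-Real.log ε)) := by
        rw [mul_pow, ← Real.exp_nat_mul]
        push_cast
        ring_nf
    _ = 4 := by
        rw [Real.exp_neg, Real.exp_log hε.1, mul_inv_cancel₀ hε.1.ne', mul_one]

lemma inv_mul_decayMass_one_add_le (hε : ε ∈ Ioo (0 : ℝ) 1) :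
    (ε * |Real.log ε|)⁻¹ * (decayMass 1 ε ^ 2 + decayMass (2 * 1) ε) ≤ 5 * |Real.log ε|⁻¹ := by
  have hε0 := hε.1
  have log_pos : 0 < |Real.log ε| := abs_pos.2 (Real.log_neg hε.1 hε.2).ne
  have mass_two_le : decayMass (2 * 1) ε ≤ ε := by
    simpa [show (2 : ℝ) - 1 = 1 by norm_num] using
      decayMass_le_of_gt (s := 2 * 1) hε.1 (by norm_num)
  calc _ ≤ (ε * |Real.log ε|)⁻¹ * ((ε * (1 + |Real.log ε|)) ^ 2 + ε) := by
        gcongr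
        exacts [decayMass_nonneg hε.1, decayMass_one_le hε.1 hε.2.le]
    _ = (ε * (1 + |Real.log ε|) ^ 2 + 1) * |Real.log ε|⁻¹ := by field_simp
    _ ≤ 5 * |Real.log ε|⁻¹ := by
        gcongr
        linarith [mul_one_add_abs_log_sq_le hε]

end Rates

section LimitingVariance

lemma PiRate_one (γ : ℝ → ℝ) (ε : ℝ) : PiRate 1 γ ε = |Real.log ε|⁻¹ + γ ε := if_pos rfl

variable {C γ : ℝ → ℝ} {β Cbar Cplus Cminus M B L : ℝ} {h : ℝ → ℝ}

namespace AsymptoticallyHomogeneous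

lemma exists_abs_rpow_mul_integral_cov_sub_le
    (hhom : AsymptoticallyHomogeneous β C γ Cbar Cplus Cminus) (hβ : β < 1) (hC : Measurable C)
    (hCM : ∀ x, |C x| ≤ M) (hh : Measurable h) (hB : ∀ x, |h x| ≤ B) :
    ∃ K, 0 ≤ K ∧ ∀ ε ∈ Ioo (0 : ℝ) 1,
      |ε ^ (-β) * ∫ p, h p.1 * h p.2 * C (p.1 / ε - p.2 / ε) ∂(unitVol.prod unitVol)
        - ∫ p, h p.1 * h p.2 * tailKernel β Cplus Cminus p.1 p.2 ∂(unitVol.prod unitVol)| ≤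
        K * PiRate β γ ε := by
  have hγ0 := hhom.rate.nonneg
  obtain ⟨Λ, hΛ⟩ := hhom.rate.bounded
  have hΛ0 : 0 ≤ Λ := (hγ0 0 le_rfl).trans (hΛ 0 le_rfl)
  have : 0 < 1 - β := sub_pos.2 hβ
  set K := B ^ 2 * (2 * (1 + Λ) / (1 - β))
  have : 0 ≤ K := by positivity
  refine ⟨K + 1, by positivity, fun ε hε => ?_⟩
  refine (le_mul_infTerm (by positivity) fun δ hδ => ?_).trans
    (mul_le_mul_of_nonneg_left (infTerm_le_PiRate hβ hε.1) (by positivity))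
  refine (abs_rpow_mul_integral_cov_sub_le hβ hC hCM hγ0 hΛ (hhom.mono hβ) (hhom.lt_one hβ) hh hB
    hε.1 hδ).trans (mul_le_mul_of_nonneg_right (le_add_of_nonneg_right zero_le_one) ?_)
  exact add_nonneg (Real.rpow_nonneg hδ.1.le _)
    (hγ0 _ (mul_nonneg (inv_nonneg.2 hδ.1.le) hε.1.le))

end AsymptoticallyHomogeneous

lemma abs_inv_log_mul_integral_sub_le {R : ℝ} (hCM : ∀ x, |C x| ≤ M) (c : ℝ) (hR : 1 < R)
    (hRL : R ≤ L) : |1 / Real.log R * (∫ x in (-R)..R, C x) - c| ≤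
      (M * (2 * L) + |c| * Real.log L) * (Real.log R)⁻¹ := by
  have hR0 : 0 < R := one_pos.trans hR
  have log_pos : 0 < Real.log R := Real.log_pos hR
  have integral_le : |∫ x in (-R)..R, C x| ≤ M * (2 * L) :=
    calc _ ≤ M * |R - -R| :=
          intervalIntegral.norm_integral_le_of_norm_le_const (f := C) fun x _ => hCM x
      _ ≤ M * (2 * L) := by
          rw [abs_of_pos (by linarith)]
          exact mul_le_mul_of_nonneg_left (by linarith) ((abs_nonneg _).trans (hCM 0))
  have one_le : 1 ≤ Real.log L * (Real.log R)⁻¹ := by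
    rw [← div_eq_mul_inv, one_le_div log_pos]
    exact Real.log_le_log hR0 hRL
  calc _ ≤ |1 / Real.log R * ∫ x in (-R)..R, C x| + |c| := abs_sub _ _
    _ = |∫ x in (-R)..R, C x| * (Real.log R)⁻¹ + |c| * 1 := by
        rw [abs_mul, one_div, abs_of_pos (inv_pos.2 log_pos), mul_comm, mul_one]
    _ ≤ M * (2 * L) * (Real.log R)⁻¹ + |c| * (Real.log L * (Real.log R)⁻¹) := by gcongr
    _ = _ := by ring

namespace AsymptoticallyHomogeneous

lemma exists_abs_inv_log_mul_integral_sub_le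
    (hhom : AsymptoticallyHomogeneous 1 C γ Cbar Cplus Cminus) (hCM : ∀ x, |C x| ≤ M) :
    ∃ K, 0 ≤ K ∧ ∀ ε ∈ Ioo (0 : ℝ) 1,
      |(|Real.log ε|⁻¹ * ∫ x in (-(1 / ε))..(1 / ε), C x) - Cbar| ≤ K * PiRate 1 γ ε := by
  obtain ⟨L₀, hL₀⟩ := eventually_atTop.1 (hhom.eq_one rfl)
  have hM0 : 0 ≤ M := (abs_nonneg _).trans (hCM 0)
  set L := max L₀ 1
  have log_L_nonneg : 0 ≤ Real.log L := Real.log_nonneg (le_max_right _ _)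
  have : 0 ≤ L := zero_le_one.trans (le_max_right _ _)
  refine ⟨1 + (M * (2 * L) + |Cbar| * Real.log L), by positivity, fun ε hε => ?_⟩
  have one_lt : 1 < 1 / ε := (one_lt_div hε.1).2 hε.2
  have log_eq : |Real.log ε| = Real.log (1 / ε) := by
    rw [abs_of_neg (Real.log_neg hε.1 hε.2), one_div, Real.log_inv]
  have hγε := hhom.rate.nonneg ε hε.1.le
  have inv_log_nonneg : 0 ≤ |Real.log ε|⁻¹ := by positivity
  have inv_log_le : |Real.log ε|⁻¹ ≤ PiRate 1 γ ε := by
    rw [PiRate_one]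
    exact le_add_of_nonneg_right hγε
  rcases le_total L (1 / ε) with h | h
  · have average_le := hL₀ (1 / ε) ((le_max_left _ _).trans h)
    rw [one_div_one_div, ← log_eq, one_div |_|] at average_le
    calc _ ≤ γ ε := average_le
      _ ≤ 1 * PiRate 1 γ ε := by
          rw [one_mul, PiRate_one]
          exact le_add_of_nonneg_left inv_log_nonneg
      _ ≤ _ := by
          have := inv_log_nonneg.trans inv_log_le
          gcongr
          exact le_add_of_nonneg_right (by positivity)
  · have average_le := abs_inv_log_mul_integral_sub_le hCM Cbar one_lt h
    rw [← log_eq, one_div |_|] at average_le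
    refine average_le.trans (mul_le_mul ?_ inv_log_le inv_log_nonneg (by positivity))
    exact le_add_of_nonneg_left zero_le_one

lemma exists_abs_inv_mul_integral_cov_sub_le
    (hhom : AsymptoticallyHomogeneous 1 C γ Cbar Cplus Cminus) (hC : Measurable C)
    (hM : ∀ x, |C x| ≤ M * (1 + |x|) ^ (-(1 : ℝ))) (hh : Measurable h) (hB : ∀ x, |h x| ≤ B)
    (hL : ∀ x y, |h x - h y| ≤ L * |x - y|) :
    ∃ K, 0 ≤ K ∧ ∀ ε ∈ Ioo (0 : ℝ) 1,
      |(ε * |Real.log ε|)⁻¹ *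
          ∫ p, h p.1 * h p.2 * C (p.1 / ε - p.2 / ε) ∂(unitVol.prod unitVol)
        - Cbar * ∫ x, h x ^ 2 ∂unitVol| ≤ K * PiRate 1 γ ε := by
  obtain ⟨K, hK, average_le⟩ :=
    hhom.exists_abs_inv_log_mul_integral_sub_le (abs_cov_le zero_le_one hM)
  have hM0 := nonneg_of_abs_cov_le hM
  have hB0 : 0 ≤ B := (abs_nonneg _).trans (hB 0)
  have hL0 : 0 ≤ L := by simpa using (abs_nonneg _).trans (hL 1 0)
  set N := ∫ x, h x ^ 2 ∂unitVol
  have hN : 0 ≤ N := integral_nonneg fun x => sq_nonneg _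
  refine ⟨2 * (B * L + B ^ 2) * M + N * K, by positivity, fun ε hε => ?_⟩
  set A := ∫ p, h p.1 * h p.2 * C (p.1 / ε - p.2 / ε) ∂(unitVol.prod unitVol)
  have hε0 := hε.1
  have log_pos : 0 < |Real.log ε| := abs_pos.2 (Real.log_neg hε.1 hε.2).ne
  have scaling : ∫ z in (-1 : ℝ)..1, C (z / ε) = ε * ∫ x in (-(1 / ε))..(1 / ε), C x := by
    rw [intervalIntegral.integral_comp_div C hε.1.ne', smul_eq_mul, neg_div]
  have decomposition : (ε * |Real.log ε|)⁻¹ * A - Cbar * N =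
      (ε * |Real.log ε|)⁻¹ * (A - N * ∫ z in (-1 : ℝ)..1, C (z / ε)) +
        N * (|Real.log ε|⁻¹ * (∫ x in (-(1 / ε))..(1 / ε), C x) - Cbar) := by
    rw [scaling]
    field_simp
    ring
  rw [decomposition, add_mul, mul_assoc N]
  refine (abs_add_le _ _).trans (add_le_add ?_ ?_)
  · calc _ = (ε * |Real.log ε|)⁻¹ * |A - N * ∫ z in (-1 : ℝ)..1, C (z / ε)| := by
          rw [abs_mul, abs_of_pos (by positivity)]
      _ ≤ (ε * |Real.log ε|)⁻¹ * (2 * (B * L + B ^ 2) * M * ε) := by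
          gcongr (_ : ℝ) * ?_
          exact abs_integral_cov_sub_mul_integral_le hC hM hh hB hL hε.1
      _ = 2 * (B * L + B ^ 2) * M * |Real.log ε|⁻¹ := by field_simp
      _ ≤ _ := by
          rw [PiRate_one]
          gcongr
          exact le_add_of_nonneg_right (hhom.rate.nonneg ε hε.1.le)
  · rw [abs_mul, abs_of_nonneg hN]
    exact mul_le_mul_of_nonneg_left (average_le ε hε) hN

end AsymptoticallyHomogeneous

lemma abs_mul_sub_mul_le_of_le {s E V A A' D K K₁ K₂ R : ℝ} (hs : 0 ≤ s) (hE : 0 ≤ E) (hK : 0 ≤ K)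
    (hV : |V - E * A| ≤ K * D) (hD : s * D ≤ K₁ * R) (hA : |s * A - A'| ≤ K₂ * R) :
    |s * V - E * A'| ≤ (K * K₁ + E * K₂) * R :=
  calc |s * V - E * A'| = |s * (V - E * A) + E * (s * A - A')| := by ring_nf
    _ ≤ s * |V - E * A| + E * |s * A - A'| := by
        refine (abs_add_le _ _).trans_eq ?_
        rw [abs_mul, abs_mul, abs_of_nonneg hs, abs_of_nonneg hE]
    _ ≤ s * (K * D) + E * (K₂ * R) := by gcongr
    _ = K * (s * D) + E * (K₂ * R) := by ring
    _ ≤ K * (K₁ * R) + E * (K₂ * R) := by gcongr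
    _ = _ := by ring

variable {Ω : Type*} [MeasurableSpace Ω] {P : Measure Ω} {G : ℝ → Ω → ℝ} {F H : ℝ → ℝ}

namespace IsStationaryGaussianField

lemma cov_zero_ne_zero (hG : IsStationaryGaussianField P G C) (hG0 : ∃ x, ¬ (G x =ᵐ[P] 0)) :
    C 0 ≠ 0 := by
  have := hG.gaussian.isProbabilityMeasure
  obtain ⟨x, hx⟩ := hG0
  contrapose! hx
  have variance_eq : Var[G x; P] = 0 := by
    rw [← covariance_self (hG.memLp_two x).aemeasurable, hG.covariance_eq, sub_self, hx]
  filter_upwards [ae_eq_integral_of_variance_eq_zero (hG.memLp_two x) variance_eq] with ω hω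
  rw [hω, hG.mean_zero, Pi.zero_apply]

lemma exists_abs_variance_weightedCov_sub_integral_cov_le (hG : IsStationaryGaussianField P G C)
    (hGm : Measurable (Function.uncurry G)) (hGc : ∀ ω, Continuous fun x => G x ω)
    (hβ : 0 ≤ β) (hM : ∀ x, |C x| ≤ M * (1 + |x|) ^ (-β)) (hF : Continuous F) (hH : Continuous H)
    (hF0 : ∫ x, F x ∂unitVol = 0) (hH0 : ∫ x, H x ∂unitVol = 0) (hB : 1 ≤ B)
    (hFB : ∀ x, |F x| ≤ B) (hHB : ∀ x, |H x| ≤ B) (hFHB : ∀ x, |F x * H x| ≤ B) :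
    ∃ K, 0 ≤ K ∧ ∀ ε, 0 < ε →
      |Var[fun ω => weightedCov (fun x => Real.exp (-G (x / ε) ω)) F H; P] - Real.exp (C 0) *
        ∫ p, F p.1 * H p.1 * (F p.2 * H p.2) * C (p.1 / ε - p.2 / ε) ∂(unitVol.prod unitVol)| ≤
          K * (decayMass β ε ^ 2 + decayMass (2 * β) ε) := by
  obtain ⟨K, hK, variance_le⟩ := hG.exists_abs_variance_weightedCov_sub_le hGm hGc hβ hM hF hH
    hF0 hH0 hB hFB hHB hFHB
  set K' := B ^ 2 * (M ^ 2 * Real.exp M)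
  have : 0 ≤ K' := by positivity
  refine ⟨K + Real.exp (C 0) * (2 * K'), by positivity, fun ε hε => ?_⟩
  have linearization_le := abs_integral_exp_cov_sub_le (hG.measurable_cov hGm) hβ hM hε
    (h := fun x => F x * H x) (hF.mul hH).measurable hFHB
  calc _ ≤ _ := abs_sub_le _ (Real.exp (C 0) * ∫ p, F p.1 * H p.1 * (F p.2 * H p.2) *
          (Real.exp (C (p.1 / ε - p.2 / ε)) - 1) ∂(unitVol.prod unitVol)) _
    _ ≤ K * decayMass β ε ^ 2 + Real.exp (C 0) * (K' * (2 * decayMass (2 * β) ε)) := by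
        rw [← mul_sub, abs_mul, Real.abs_exp]
        exact add_le_add (variance_le ε hε)
          (mul_le_mul_of_nonneg_left linearization_le (Real.exp_pos _).le)
    _ ≤ (K + Real.exp (C 0) * (2 * K')) * (decayMass β ε ^ 2 + decayMass (2 * β) ε) := by
        have := sq_nonneg (decayMass β ε)
        have mass_nonneg := decayMass_nonneg (s := 2 * β) hε
        have : 0 ≤ Real.exp (C 0) * (2 * K') * decayMass β ε ^ 2 := by positivity
        linarith [mul_nonneg hK mass_nonneg]

end IsStationaryGaussianField

end LimitingVariance

section CenteredExtension

variable {f g : ℝ → ℝ}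

/-- The extension of `f - f̄` from `[0, 1]` to `ℝ` by its boundary values, a bounded Lipschitz
function if `f` is `C¹` on `[0, 1]`. -/
noncomputable def centeredExt (f : ℝ → ℝ) : ℝ → ℝ :=
  IccExtend zero_le_one ((Icc 0 1).domRestrict (centered f))

lemma centeredExt_of_mem {x : ℝ} (hx : x ∈ Icc (0 : ℝ) 1) : centeredExt f x = centered f x :=
  IccExtend_of_mem _ _ hx

lemma exists_lipschitzWith_centeredExt (hf : ContDiffOn ℝ 1 f (Icc 0 1)) :
    ∃ K, LipschitzWith K (centeredExt f) := by
  obtain ⟨K, hK⟩ := hf.exists_lipschitzOnWith one_ne_zero (convex_Icc 0 1) isCompact_Icc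
  have centered_lipschitz : LipschitzOnWith K (centered f) (Icc 0 1) := fun x hx y hy => by
    simpa [centered, edist_dist, dist_eq_norm] using hK hx hy
  exact ⟨K * 1, centered_lipschitz.to_restrict.comp (LipschitzWith.projIcc zero_le_one)⟩

lemma continuous_centeredExt (hf : ContDiffOn ℝ 1 f (Icc 0 1)) : Continuous (centeredExt f) :=
  (exists_lipschitzWith_centeredExt hf).choose_spec.continuous

lemma integral_centeredExt (hf : ContDiffOn ℝ 1 f (Icc 0 1)) :
    ∫ x, centeredExt f x ∂unitVol = 0 := by
  have f_integrable : IntervalIntegrable f volume 0 1 :=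
    ContinuousOn.intervalIntegrable_of_Icc zero_le_one hf.continuousOn
  calc ∫ x, centeredExt f x ∂unitVol = ∫ x in (0 : ℝ)..1, centered f x := by
        rw [integral_unitVol]
        refine intervalIntegral.integral_congr fun x hx => ?_
        rw [uIcc_of_le zero_le_one] at hx
        exact centeredExt_of_mem hx
    _ = 0 := by
        unfold centered
        rw [intervalIntegral.integral_sub f_integrable intervalIntegrable_const]
        simp

lemma exists_abs_centeredExt_le (hf : ContDiffOn ℝ 1 f (Icc 0 1)) :
    ∃ B, ∀ x, |centeredExt f x| ≤ B := by
  obtain ⟨B, hB⟩ := isCompact_Icc.exists_bound_of_continuousOn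
    (f := centered f) (hf.continuousOn.sub continuousOn_const)
  exact ⟨B, fun x => hB _ (projIcc 0 1 zero_le_one x).2⟩

lemma exists_abs_centeredExt_mul_le (hf : ContDiffOn ℝ 1 f (Icc 0 1))
    (hg : ContDiffOn ℝ 1 g (Icc 0 1)) :
    ∃ B, 1 ≤ B ∧ (∀ x, |centeredExt f x| ≤ B) ∧ (∀ x, |centeredExt g x| ≤ B) ∧
      ∀ x, |centeredExt f x * centeredExt g x| ≤ B := by
  obtain ⟨B₁, hB₁⟩ := exists_abs_centeredExt_le hf
  obtain ⟨B₂, hB₂⟩ := exists_abs_centeredExt_le hg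
  refine ⟨max (max 1 (B₁ * B₂)) (max B₁ B₂), by simp, fun x => by simp [hB₁ x],
    fun x => by simp [hB₂ x], fun x => le_max_of_le_left (le_max_of_le_right ?_)⟩
  rw [abs_mul]
  exact mul_le_mul (hB₁ x) (hB₂ x) (abs_nonneg _) ((abs_nonneg _).trans (hB₁ x))

lemma exists_abs_centeredExt_mul_sub_le (hf : ContDiffOn ℝ 1 f (Icc 0 1))
    (hg : ContDiffOn ℝ 1 g (Icc 0 1)) :
    ∃ L, ∀ x y, |centeredExt f x * centeredExt g x - centeredExt f y * centeredExt g y| ≤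
      L * |x - y| := by
  obtain ⟨B, -, hfB, hgB, -⟩ := exists_abs_centeredExt_mul_le hf hg
  obtain ⟨L₁, hL₁⟩ := exists_lipschitzWith_centeredExt hf
  obtain ⟨L₂, hL₂⟩ := exists_lipschitzWith_centeredExt hg
  have hB : 0 ≤ B := (abs_nonneg _).trans (hfB 0)
  refine ⟨B * L₂ + B * L₁, fun x y => ?_⟩
  calc _ = |centeredExt f x * (centeredExt g x - centeredExt g y) +
        centeredExt g y * (centeredExt f x - centeredExt f y)| := by ring_nf
    _ ≤ |centeredExt f x| * |centeredExt g x - centeredExt g y| +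
        |centeredExt g y| * |centeredExt f x - centeredExt f y| := by
        refine (abs_add_le _ _).trans_eq ?_
        rw [abs_mul, abs_mul]
    _ ≤ B * (L₂ * |x - y|) + B * (L₁ * |x - y|) := by
        gcongr
        exacts [hfB x, hL₂.dist_le_mul x y, hgB y, hL₁.dist_le_mul x y]
    _ = _ := by ring

lemma IsSolution.gradAverage_eq_weightedCov_centeredExt {H u : ℝ → ℝ} {ε : ℝ}
    (hu : IsSolution (fun x => Real.exp (H x)) ε f u) (hH : Continuous H)
    (hf : ContDiffOn ℝ 1 f (Icc 0 1)) (hg : ContDiffOn ℝ 1 g (Icc 0 1)) :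
    gradAverage u g =
      weightedCov (fun x => Real.exp (-H (x / ε))) (centeredExt f) (centeredExt g) := by
  have eq_add_mean {φ : ℝ → ℝ} (x) (hx : x ∈ Icc (0 : ℝ) 1) :
      φ x = centeredExt φ x + ∫ y in (0 : ℝ)..1, φ y := by
    rw [centeredExt_of_mem hx, centered, sub_add_cancel]
  refine IsSolution.gradAverage_eq (w := fun x => Real.exp (-H x)) ?_ (by fun_prop)
    (fun x => Real.exp_pos _) hf (continuous_centeredExt hf) (continuous_centeredExt hg)
    eq_add_mean eq_add_mean
  simpa only [Real.exp_neg, inv_inv] using hu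

end CenteredExtension

section Fluctuations

variable {f g : ℝ → ℝ} {β ε : ℝ} {Ω : Type*} [MeasurableSpace Ω] {P : Measure Ω}

lemma sigmaSq_of_lt (hβ : β < 1) (C₀ Cbar Cplus Cminus : ℝ) (hf : ContDiffOn ℝ 1 f (Icc 0 1))
    (hg : ContDiffOn ℝ 1 g (Icc 0 1)) :
    sigmaSq β C₀ Cbar Cplus Cminus f g = Real.exp C₀ *
      ∫ p, centeredExt f p.1 * centeredExt g p.1 * (centeredExt f p.2 * centeredExt g p.2) *
        tailKernel β Cplus Cminus p.1 p.2 ∂(unitVol.prod unitVol) := by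
  obtain ⟨B, -, -, -, hB⟩ := exists_abs_centeredExt_mul_le hf hg
  rw [sigmaSq, quadForm, if_pos hβ, integral_prod _ (integrable_mul_tailKernel hβ Cplus Cminus
    (h := fun x => centeredExt f x * centeredExt g x)
    ((continuous_centeredExt hf).mul (continuous_centeredExt hg)).measurable hB)]
  simp only [← integral_unitVol]
  congr 1
  refine integral_congr_ae (ae_mem_unitVol.mono fun x hx => ?_)
  refine integral_congr_ae (ae_mem_unitVol.mono fun y hy => ?_)
  simp only [centeredExt_of_mem (Ioc_subset_Icc_self hx),
    centeredExt_of_mem (Ioc_subset_Icc_self hy), tailKernel]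
  ring

lemma sigmaSq_one (C₀ Cbar Cplus Cminus : ℝ) (f g : ℝ → ℝ) :
    sigmaSq 1 C₀ Cbar Cplus Cminus f g =
      Real.exp C₀ * (Cbar * ∫ x, (centeredExt f x * centeredExt g x) ^ 2 ∂unitVol) := by
  rw [sigmaSq, quadForm, if_neg (lt_irrefl _), ← integral_unitVol]
  congr 2
  refine integral_congr_ae (ae_mem_unitVol.mono fun x hx => ?_)
  simp only [centeredExt_of_mem (Ioc_subset_Icc_self hx)]

lemma sigmaEps_sq_of_lt (P : Measure Ω) (hβ : β < 1) (hε : 0 < ε) (I : Ω → ℝ) :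
    sigmaEps P β ε I ^ 2 = ε ^ (-β) * Var[I; P] := by
  rw [sigmaEps, mul_pow, Real.sq_sqrt (variance_nonneg _ _), piRate, if_pos hβ, inv_pow,
    ← Real.rpow_mul_natCast hε.le, ← Real.rpow_neg hε.le, Nat.cast_ofNat,
    div_mul_cancel₀ β two_ne_zero]

lemma sigmaEps_sq_one (P : Measure Ω) (hε : 0 < ε) (I : Ω → ℝ) :
    sigmaEps P 1 ε I ^ 2 = (ε * |Real.log ε|)⁻¹ * Var[I; P] := by
  rw [sigmaEps, mul_pow, Real.sq_sqrt (variance_nonneg _ _), piRate, if_neg (lt_irrefl _),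
    inv_pow, mul_pow, Real.sq_sqrt hε.le, ← Real.sqrt_eq_rpow, Real.sq_sqrt (abs_nonneg _)]

lemma sigmaEps_congr {I J : Ω → ℝ} (hIJ : I =ᵐ[P] J) : sigmaEps P β ε I = sigmaEps P β ε J := by
  rw [sigmaEps, sigmaEps, variance_congr hIJ]

variable {G : ℝ → Ω → ℝ} {C γ : ℝ → ℝ} {M Cbar Cplus Cminus : ℝ}

namespace IsStationaryGaussianField

lemma memLp_weightedCov_centeredExt (hG : IsStationaryGaussianField P G C)
    (hGm : Measurable (Function.uncurry G)) (hGc : ∀ ω, Continuous fun x => G x ω)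
    (hM : ∀ x, |C x| ≤ M) (hf : ContDiffOn ℝ 1 f (Icc 0 1)) (hg : ContDiffOn ℝ 1 g (Icc 0 1)) :
    MemLp (fun ω => weightedCov (fun x => Real.exp (-G (x / ε) ω)) (centeredExt f)
      (centeredExt g)) 2 P := by
  obtain ⟨B, hB1, hfB, hgB, hB⟩ := exists_abs_centeredExt_mul_le hf hg
  exact hG.memLp_weightedCov_exp_neg hGm hGc hM (continuous_centeredExt hf)
    (continuous_centeredExt hg) (integral_centeredExt hf) (integral_centeredExt hg) hB1 hfB hgB hB

lemma exists_abs_sigmaEps_sq_sub_sigmaSq_le_of_lt (hG : IsStationaryGaussianField P G C)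
    (hGm : Measurable (Function.uncurry G)) (hGc : ∀ ω, Continuous fun x => G x ω) (hC0 : C 0 ≠ 0)
    (hC : ContinuousAt C 0) (hβ0 : 0 < β) (hβ1 : β < 1) (hM : ∀ x, |C x| ≤ M * (1 + |x|) ^ (-β))
    (hhom : AsymptoticallyHomogeneous β C γ Cbar Cplus Cminus)
    (hf : ContDiffOn ℝ 1 f (Icc 0 1)) (hg : ContDiffOn ℝ 1 g (Icc 0 1)) :
    ∃ K, ∀ ε ∈ Ioo (0 : ℝ) 1, |sigmaEps P β ε (fun ω => weightedCov (fun x =>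
        Real.exp (-G (x / ε) ω)) (centeredExt f) (centeredExt g)) ^ 2 -
      sigmaSq β (C 0) Cbar Cplus Cminus f g| ≤ K * PiRate β γ ε := by
  obtain ⟨B, hB1, hfB, hgB, hB⟩ := exists_abs_centeredExt_mul_le hf hg
  have hf' := continuous_centeredExt hf
  have hg' := continuous_centeredExt hg
  have rate_pos := exists_rate_pos hβ0 hC hC0 fun x hx => (hhom.lt_one hβ1 x hx).1
  obtain ⟨K, hK, variance_le⟩ := hG.exists_abs_variance_weightedCov_sub_integral_cov_le hGm hGc
    hβ0.le hM hf' hg' (integral_centeredExt hf) (integral_centeredExt hg) hB1 hfB hgB hB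
  obtain ⟨K₁, -, error_le⟩ := exists_rpow_neg_mul_decayMass_add_le hβ0.le hβ1 hhom.rate.nonneg
    (hhom.mono hβ1) rate_pos
  obtain ⟨K₂, -, leading_le⟩ := hhom.exists_abs_rpow_mul_integral_cov_sub_le hβ1
    (hG.measurable_cov hGm) (abs_cov_le hβ0.le hM) (hf'.mul hg').measurable hB
  refine ⟨K * K₁ + Real.exp (C 0) * K₂, fun ε hε => ?_⟩
  rw [sigmaEps_sq_of_lt P hβ1 hε.1, sigmaSq_of_lt hβ1 _ _ _ _ hf hg]
  exact abs_mul_sub_mul_le_of_le (Real.rpow_nonneg hε.1.le _) (Real.exp_pos _).le hK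
    (variance_le ε hε.1) (error_le ε hε) (leading_le ε hε)

lemma exists_abs_sigmaEps_sq_sub_sigmaSq_le_of_eq_one (hG : IsStationaryGaussianField P G C)
    (hGm : Measurable (Function.uncurry G)) (hGc : ∀ ω, Continuous fun x => G x ω)
    (hM : ∀ x, |C x| ≤ M * (1 + |x|) ^ (-(1 : ℝ)))
    (hhom : AsymptoticallyHomogeneous 1 C γ Cbar Cplus Cminus)
    (hf : ContDiffOn ℝ 1 f (Icc 0 1)) (hg : ContDiffOn ℝ 1 g (Icc 0 1)) :
    ∃ K, ∀ ε ∈ Ioo (0 : ℝ) 1, |sigmaEps P 1 ε (fun ω => weightedCov (fun x =>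
        Real.exp (-G (x / ε) ω)) (centeredExt f) (centeredExt g)) ^ 2 -
      sigmaSq 1 (C 0) Cbar Cplus Cminus f g| ≤ K * PiRate 1 γ ε := by
  obtain ⟨B, hB1, hfB, hgB, hB⟩ := exists_abs_centeredExt_mul_le hf hg
  obtain ⟨L, hL⟩ := exists_abs_centeredExt_mul_sub_le hf hg
  have hf' := continuous_centeredExt hf
  have hg' := continuous_centeredExt hg
  obtain ⟨K, hK, variance_le⟩ := hG.exists_abs_variance_weightedCov_sub_integral_cov_le hGm hGc
    zero_le_one hM hf' hg' (integral_centeredExt hf) (integral_centeredExt hg) hB1 hfB hgB hB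
  obtain ⟨K₂, -, leading_le⟩ := hhom.exists_abs_inv_mul_integral_cov_sub_le
    (hG.measurable_cov hGm) hM (hf'.mul hg').measurable hB hL
  refine ⟨K * 5 + Real.exp (C 0) * K₂, fun ε hε => ?_⟩
  have inv_log_le : |Real.log ε|⁻¹ ≤ PiRate 1 γ ε := by
    rw [PiRate_one]
    exact le_add_of_nonneg_right (hhom.rate.nonneg ε hε.1.le)
  rw [sigmaEps_sq_one P hε.1, sigmaSq_one]
  exact abs_mul_sub_mul_le_of_le (inv_nonneg.2 (mul_nonneg hε.1.le (abs_nonneg _)))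
    (Real.exp_pos _).le hK (variance_le ε hε.1)
    ((inv_mul_decayMass_one_add_le hε).trans (by gcongr)) (leading_le ε hε)

lemma exists_abs_sigmaEps_sq_sub_sigmaSq_le (hG : IsStationaryGaussianField P G C)
    (hGm : Measurable (Function.uncurry G)) (hGc : ∀ ω, Continuous fun x => G x ω) (hC0 : C 0 ≠ 0)
    (hC : ContinuousAt C 0) (hβ0 : 0 < β) (hβ1 : β ≤ 1) (hM : ∀ x, |C x| ≤ M * (1 + |x|) ^ (-β))
    (hhom : AsymptoticallyHomogeneous β C γ Cbar Cplus Cminus)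
    (hf : ContDiffOn ℝ 1 f (Icc 0 1)) (hg : ContDiffOn ℝ 1 g (Icc 0 1)) :
    ∃ K, ∀ ε ∈ Ioo (0 : ℝ) 1, |sigmaEps P β ε (fun ω => weightedCov (fun x =>
        Real.exp (-G (x / ε) ω)) (centeredExt f) (centeredExt g)) ^ 2 -
      sigmaSq β (C 0) Cbar Cplus Cminus f g| ≤ K * PiRate β γ ε := by
  rcases hβ1.lt_or_eq with hβ | rfl
  · exact hG.exists_abs_sigmaEps_sq_sub_sigmaSq_le_of_lt hGm hGc hC0 hC hβ0 hβ hM hhom hf hg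
  · exact hG.exists_abs_sigmaEps_sq_sub_sigmaSq_le_of_eq_one hGm hGc hM hhom hf hg

end IsStationaryGaussianField

lemma ae_gradAverage_eq_weightedCov {H : ℝ → Ω → ℝ} {u : Ω → ℝ → ℝ}
    (hGH : ∀ᵐ ω ∂P, ∀ x, G x ω = H x ω) (hHc : ∀ ω, Continuous fun x => H x ω)
    (hf : ContDiffOn ℝ 1 f (Icc 0 1)) (hg : ContDiffOn ℝ 1 g (Icc 0 1))
    (hu : ∀ᵐ ω ∂P, IsSolution (fun x => Real.exp (G x ω)) ε f (u ω)) :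
    (fun ω => gradAverage (u ω) g) =ᵐ[P] fun ω =>
      weightedCov (fun x => Real.exp (-H (x / ε) ω)) (centeredExt f) (centeredExt g) := by
  filter_upwards [hGH, hu] with ω hω huω
  simp only [hω] at huω
  exact huω.gradAverage_eq_weightedCov_centeredExt (hHc ω) hf hg

end Fluctuations

end LogNormalHomog

theorem mainTheorem6 {Ω : Type*} [MeasurableSpace Ω] (P : Measure Ω) [IsProbabilityMeasure P]
    (β : ℝ) (hβ0 : 0 < β) (hβ1 : β ≤ 1)
    (G : ℝ → Ω → ℝ) (C : ℝ → ℝ)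
    (hG : LogNormalHomog.IsStationaryGaussianField P G C)
    (hG0 : ∃ x, ¬ (G x =ᵐ[P] 0))
    (hCholder : LogNormalHomog.HolderAtZero C)
    (hCdecay : LogNormalHomog.DecaysWithExponent C β)
    (γ : ℝ → ℝ) (Cbar Cplus Cminus : ℝ)
    (hhom : LogNormalHomog.AsymptoticallyHomogeneous β C γ Cbar Cplus Cminus)
    (f g : ℝ → ℝ) (hf : ContDiffOn ℝ 1 f (Icc 0 1)) (hg : ContDiffOn ℝ 1 g (Icc 0 1))
    (u v : ℝ → Ω → ℝ → ℝ)
    (hu : ∀ ε ∈ Ioo (0 : ℝ) 1, ∀ᵐ ω ∂P,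
      LogNormalHomog.IsSolution (fun x => Real.exp (G x ω)) ε f (u ε ω))
    (hv : ∀ ε ∈ Ioo (0 : ℝ) 1, ∀ᵐ ω ∂P,
      LogNormalHomog.IsSolution (fun x => Real.exp (G x ω)) ε g (v ε ω)) :
    (∀ ε ∈ Ioo (0 : ℝ) 1,
      (∀ᵐ ω ∂P, LogNormalHomog.gradAverage (u ε ω) g = LogNormalHomog.gradAverage (v ε ω) f) ∧
      MemLp (fun ω => LogNormalHomog.gradAverage (u ε ω) g) 2 P) ∧
    ∃ K : ℝ, ∀ ε ∈ Ioo (0 : ℝ) 1,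
      |LogNormalHomog.sigmaEps P β ε (fun ω => LogNormalHomog.gradAverage (u ε ω) g) ^ 2
          - LogNormalHomog.sigmaSq β (C 0) Cbar Cplus Cminus f g|
        ≤ K * LogNormalHomog.PiRate β γ ε := by
  open LogNormalHomog in
  obtain ⟨H, hHm, hHc, hGH, hH⟩ := hG.exists_measurable_version
  obtain ⟨M, hM⟩ := hCdecay
  have hIu (ε) (hε : ε ∈ Ioo (0 : ℝ) 1) := ae_gradAverage_eq_weightedCov hGH hHc hf hg (hu ε hε)
  have hIv (ε) (hε : ε ∈ Ioo (0 : ℝ) 1) := ae_gradAverage_eq_weightedCov hGH hHc hg hf (hv ε hε)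
  refine ⟨fun ε hε => ⟨?symm, ?memLp⟩, ?rate⟩
  case symm =>
    filter_upwards [hIu ε hε, hIv ε hε] with ω hω hω'
    rw [hω, hω', weightedCov_comm]
  case memLp =>
    exact (memLp_congr_ae (hIu ε hε)).2
      (hH.memLp_weightedCov_centeredExt hHm hHc (abs_cov_le hβ0.le hM) hf hg)
  case rate =>
    obtain ⟨K, hK⟩ := hH.exists_abs_sigmaEps_sq_sub_sigmaSq_le hHm hHc (hG.cov_zero_ne_zero hG0)
      hCholder.continuousAt hβ0 hβ1 hM hhom hf hg
    exact ⟨K, fun ε hε => by rw [sigmaEps_congr (hIu ε hε)]; exact hK ε hε⟩
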